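/- Let $n,d\ge 1$, let $A_0,\dots,A_d\in\mathbb C^{n\times n}$ with $\det A_0\ne 0$ and $A_d\neq 0$, and let $P(\lambda)=A_0+A_1\lambda+\dots+A_d\lambda^d$. Let $\zeta_1,\dots,\zeta_{nd}\in\mathbb C\cup\{\infty\}$ be the eigenvalues of $P$, that is, the roots of $\det P$ counted with multiplicity together with $\infty$ counted $nd-\deg\det P$ times, arranged by non-decreasing modulus ($|\infty|=+\infty$). Let $\|\cdot\|$ be a norm on the complex vector space $\mathbb C^{n\times n}$, put $c=|\det A_0|/\|A_0\|^n$, and consider the following two assumptions on the norm, where $\|A\|_{\mathrm{nF}}=\big(\frac1n\sum_{i,l}|A_{il}|^2\big)^{1/2}$: (A1) $|\det A|\le\|A\|^n$ for all $A\in\mathbb C^{n\times n}$; (A2) there are $Q,Q'\in\mathbb C^{n\times n}$ with $\det Q=\det Q'=1$ and $\|QAQ'\|_{\mathrm{nF}}\le\|A\|$ for all $A\in\mathbb C^{n\times n}$. Let $\alpha_1\le\dots\le\alpha_d$ be the tropical roots of $\mathsf{t}p(x)=\max_{0\le j\le d}\|A_j\|x^j$, i.e. the unique nonnegative reals in non-decreasing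 order such that $\mathsf{t}p(x)=\|A_d\|\prod_{l=1}^d\max(x,\alpha_l)$ for all $x\ge0$; put $\alpha_0=0$ and $\alpha_{d+1}=+\infty$. Let $k_0=0<k_1<\dots<k_q=d$ be the abscissae of the vertices of the Newton polygon of $\mathsf{t}p$, that is, of the upper boundary of the convex hull of $\{(j,y): j\in\mathbb N,\ 0\le j\le d,\ y\in\mathbb R,\ y\le\log\|A_j\|\}$ (with $\log 0=-\infty$), and put $\delta_j=\alpha_{k_j}/\alpha_{k_j+1}$ for $0\le j\le q$ (so $\delta_0=\delta_q=0$). Let $\mathcal E(0)=1$, $\mathcal E(m)=\left(\frac{m+1}{m}\right)^m$ for $m\ge1$, and $$\mathcal U(m,\delta)=\mathcal E(m)\,\frac{1+\delta+\sqrt{m^2(1-\delta)^2+4\delta}}{1-\delta}\qquad(m\in\mathbb N,\ 0\le\delta\le1),$$ with the conventions $\mathcal U(m,1)=+\infty$ and $1/\infty=0$. Let $1\le k\le d$. Then there is a unique $j\in\{1,\dots,q\}$ with $k_{j-1}<k\le k_j$, and for this $j$ one has $\alpha_k=\alpha_{k_{j-1}+1}=\alpha_{k_j}$. Set $$L_k=\max(L_k^+,L_k^-),\qquad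 L_k^+=\frac1{\mathcal U(k_j-k,\delta_j)},\qquad L_k^-=\frac1{\mathcal U(k-k_{j-1},\delta_{j-1})},$$ $$L_k^*=\max(L_k^{+*},L_k^{-*}),\qquad L_k^{+*}=\frac1{\sqrt{\mathcal U(k_j-k,\delta_j^2)}},\qquad L_k^{-*}=\frac1{\sqrt{\mathcal U(k-k_{j-1},\delta_{j-1}^2)}}.$$ If (A1) holds, then $$\frac{|\zeta_1\cdots\zeta_{nk}|}{(\alpha_1\cdots\alpha_k)^n}\ge c\,(L_k)^n .$$ If (A2) holds, then this inequality holds with $L_k$ replaced by $L_k^*$. Moreover $L_k^*\ge L_k$ in all cases, and if $k=k_j$ then $$L_k\ge L_k^+=\frac{1-\sqrt{\delta_j}}{1+\sqrt{\delta_j}},\qquad L_k^*\ge L_k^{+*}=\sqrt{\frac{1-\delta_j}{1+\delta_j}} .$$ -/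

import Mathlib

open scoped ENNReal

/-- The max-times tropical polynomial `x ↦ max_{0 ≤ j ≤ d} a_j x^j` (used for `x ≥ 0`, `a_j ≥ 0`). -/
noncomputable def tropPoly (a : ℕ → ℝ) (d : ℕ) (x : ℝ) : ℝ :=
  (Finset.range (d + 1)).sup' Finset.nonempty_range_add_one (fun j => a j * x ^ j)

/-- `α 0 ≤ ... ≤ α (d-1)` are the tropical roots, counted with multiplicities, of the max-times
polynomial with coefficients `a 0, ..., a d`: the corresponding polynomial function factors as
`a_d ∏ max(x, α_l)`. -/
def IsTropicalRoots (a : ℕ → ℝ) (d : ℕ) (α : Fin d → ℝ) : Prop :=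
  Monotone α ∧ (∀ l, 0 ≤ α l) ∧ ∀ x : ℝ, 0 ≤ x → tropPoly a d x = a d * ∏ l, max x (α l)

theorem tropPoly_eq_iff {a : ℕ → ℝ} {d : ℕ} {x y : ℝ} :
    tropPoly a d x = y ↔ (∀ j ≤ d, a j * x ^ j ≤ y) ∧ ∃ j ≤ d, a j * x ^ j = y := by
  unfold tropPoly
  constructor
  · rintro rfl
    refine ⟨fun j hj => Finset.le_sup' (fun j => a j * x ^ j)
      (Finset.mem_range.2 (Nat.lt_succ_of_le hj)), ?_⟩
    obtain ⟨j, hj, h⟩ := Finset.exists_mem_eq_sup' (s := Finset.range (d + 1))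
      Finset.nonempty_range_add_one (fun j => a j * x ^ j)
    exact ⟨j, Nat.le_of_lt_succ (Finset.mem_range.1 hj), h.symm⟩
  · rintro ⟨h1, j, hj, rfl⟩
    refine le_antisymm (Finset.sup'_le _ _ fun i hi => h1 i ?_)
      (Finset.le_sup' (fun j => a j * x ^ j) (Finset.mem_range.2 (Nat.lt_succ_of_le hj)))
    exact Nat.le_of_lt_succ (Finset.mem_range.1 hi)

theorem exists_tropicalRoots_aux (a : ℕ → ℝ) (ha : ∀ j, 0 ≤ a j) (d : ℕ) (had : 0 < a d) :
    ∃ α : ℕ → ℝ, (∀ i j, i ≤ j → j < d → α i ≤ α j) ∧ (∀ l, 0 ≤ α l) ∧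
      ∀ x : ℝ, 0 ≤ x → tropPoly a d x = a d * ∏ l ∈ Finset.range d, max x (α l) := by
  induction d using Nat.strong_induction_on with
  | _ d ih =>
  rcases Nat.eq_zero_or_pos d with rfl | hd
  · refine ⟨fun _ => 0, fun _ _ _ h => absurd h (Nat.not_lt_zero _), fun _ => le_rfl, ?_⟩
    intro x hx
    simp [tropPoly]
  · obtain ⟨m, hm, hmax⟩ := Finset.exists_max_image (Finset.range d)
      (fun j => (a j / a d) ^ (1 / ((d - j : ℕ) : ℝ))) ⟨0, Finset.mem_range.2 hd⟩
    have hmd : m < d := Finset.mem_range.1 hm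
    set r : ℝ := (a m / a d) ^ (1 / ((d - m : ℕ) : ℝ)) with hr
    have hr0 : 0 ≤ r := Real.rpow_nonneg (div_nonneg (ha m) had.le) _
    have key : ∀ j < d, ((a j / a d) ^ (1 / ((d - j : ℕ) : ℝ))) ^ (d - j) = a j / a d := by
      intro j hj
      have h0 : (d - j : ℕ) ≠ 0 := by omega
      rw [one_div]
      exact Real.rpow_inv_natCast_pow (div_nonneg (ha j) had.le) h0
    have hle : ∀ j < d, a j ≤ a d * r ^ (d - j) := by
      intro j hj
      have h1 : a j / a d ≤ r ^ (d - j) := by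
        rw [← key j hj]
        exact pow_le_pow_left₀ (Real.rpow_nonneg (div_nonneg (ha j) had.le) _)
          (hmax j (Finset.mem_range.2 hj)) _
      rw [div_le_iff₀ had] at h1
      linarith
    have heq : a m = a d * r ^ (d - m) := by
      rw [hr, key m hmd]; field_simp
    have hbig : ∀ x, r ≤ x → tropPoly a d x = a d * x ^ d := by
      intro x hx
      refine tropPoly_eq_iff.2 ⟨fun j hj => ?_, d, le_rfl, rfl⟩
      rcases hj.lt_or_eq with hj | rfl
      · have hx0 : 0 ≤ x := hr0.trans hx
        calc a j * x ^ j ≤ (a d * r ^ (d - j)) * x ^ j := by gcongr; exact hle j hj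
          _ ≤ (a d * x ^ (d - j)) * x ^ j := by gcongr
          _ = a d * x ^ d := by rw [mul_assoc, ← pow_add, Nat.sub_add_cancel hj.le]
      · exact le_rfl
    rcases hr0.eq_or_lt with h0 | hrpos
    · refine ⟨fun _ => 0, fun _ _ _ _ => le_rfl, fun _ => le_rfl, fun x hx => ?_⟩
      rw [hbig x (h0 ▸ hx)]
      simp [max_eq_left hx]
    · have ham : 0 < a m := by rw [heq]; positivity
      obtain ⟨β, hβm, hβ0, hβ⟩ := ih m hmd ham
      have hβr : ∀ l < m, β l ≤ r := by
        intro l hl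
        by_contra! hlt
        have h1 := (tropPoly_eq_iff.1 (hβ r hr0)).2
        obtain ⟨j, hj, h1⟩ := h1
        have h2 : a j * r ^ j ≤ a d * r ^ d := (tropPoly_eq_iff.1 (hbig r le_rfl)).1 j (by omega)
        have h3 : a d * r ^ d = a m * r ^ m := by
          rw [heq, mul_assoc, ← pow_add, Nat.sub_add_cancel hmd.le]
        have h4 : r ^ m < ∏ l ∈ Finset.range m, max r (β l) := by
          have : r ^ m = ∏ l ∈ Finset.range m, r := by simp
          rw [this]
          exact Finset.prod_lt_prod (fun _ _ => hrpos) (fun _ _ => le_max_left _ _)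
            ⟨l, Finset.mem_range.2 hl, lt_max_of_lt_right hlt⟩
        have h5 := mul_lt_mul_of_pos_left h4 ham
        linarith
      refine ⟨fun l => if l < m then β l else r, ?_, ?_, ?_⟩
      · intro i j hij hj
        dsimp only
        split_ifs with h1 h2 h2
        · exact hβm i j hij h2
        · exact hβr i h1
        · omega
        · exact le_rfl
      · intro l
        dsimp only
        split_ifs
        · exact hβ0 l
        · exact hr0
      · intro x hx
        rcases le_total r x with hrx | hxr
        · rw [hbig x hrx]
          congr 1
          rw [Finset.prod_congr rfl (g := fun _ => x), Finset.prod_const, Finset.card_range]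
          intro l _
          dsimp only
          split_ifs with h
          · exact max_eq_left ((hβr l h).trans hrx)
          · exact max_eq_left hrx
        · have hprod : ∏ l ∈ Finset.range d, max x (if l < m then β l else r)
              = (∏ l ∈ Finset.range m, max x (β l)) * r ^ (d - m) := by
            rw [← Finset.prod_range_mul_prod_Ico _ hmd.le]
            congr 1
            · refine Finset.prod_congr rfl fun l hl => ?_
              rw [if_pos (Finset.mem_range.1 hl)]
            · rw [Finset.prod_congr rfl (g := fun _ => r), Finset.prod_const, Nat.card_Ico]
              intro l hl
              rw [if_neg (by have := (Finset.mem_Ico.1 hl).1; omega), max_eq_right hxr]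
          rw [hprod]
          have h1 : a d * ((∏ l ∈ Finset.range m, max x (β l)) * r ^ (d - m))
              = tropPoly a m x := by rw [hβ x hx, heq]; ring
          rw [h1]
          have h2 := tropPoly_eq_iff.1 (rfl : tropPoly a m x = tropPoly a m x)
          refine tropPoly_eq_iff.2 ⟨fun j hj => ?_, ?_⟩
          · by_cases hjm : j ≤ m
            · exact h2.1 j hjm
            · refine le_trans ?_ (h2.1 m le_rfl)
              have h3 : a j ≤ a d * r ^ (d - j) := by
                rcases hj.lt_or_eq with h | rfl
                · exact hle j h
                · simp
              calc a j * x ^ j ≤ (a d * r ^ (d - j)) * x ^ j := by gcongr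
                _ = a d * r ^ (d - j) * x ^ (j - m) * x ^ m := by
                    rw [mul_assoc (a d * r ^ (d - j)), ← pow_add, Nat.sub_add_cancel (by omega)]
                _ ≤ a d * r ^ (d - j) * r ^ (j - m) * x ^ m := by gcongr
                _ = a m * x ^ m := by
                    rw [heq, mul_assoc (a d), ← pow_add]
                    congr 3
                    omega
          · obtain ⟨j, hj, h⟩ := h2.2
            exact ⟨j, by omega, h⟩

/-- Existence of the tropical factorization. -/
theorem exists_isTropicalRoots (a : ℕ → ℝ) (ha : ∀ j, 0 ≤ a j) (d : ℕ) (had : 0 < a d) :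
    ∃ α : Fin d → ℝ, IsTropicalRoots a d α := by
  obtain ⟨α, h1, h2, h3⟩ := exists_tropicalRoots_aux a ha d had
  refine ⟨fun l => α l, fun i j hij => h1 i j hij j.2, fun l => h2 l, fun x hx => ?_⟩
  rw [h3 x hx, Fin.prod_univ_eq_prod_range (fun l => max x (α l)) d]

theorem tropicalRoots_unique_aux (d : ℕ) (α β : Fin d → ℝ) (hα : Monotone α) (hβ : Monotone β)
    (hα0 : ∀ l, 0 ≤ α l) (hβ0 : ∀ l, 0 ≤ β l)
    (h : ∀ x : ℝ, 0 < x → ∏ l, max x (α l) = ∏ l, max x (β l)) : α = β := by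
  induction d with
  | zero => exact Subsingleton.elim _ _
  | succ d ih =>
    have not_lt : ∀ γ ε : Fin (d + 1) → ℝ, Monotone γ → (∀ l, 0 ≤ γ l) →
        (∀ x : ℝ, 0 < x → ∏ l, max x (γ l) = ∏ l, max x (ε l)) →
        ¬ γ (Fin.last d) < ε (Fin.last d) := by
      intro γ ε hγ hγ0 hγε hlt
      obtain ⟨x, hx1, hx2⟩ := exists_between hlt
      have hx : 0 < x := (hγ0 _).trans_lt hx1
      have e1 : ∏ l, max x (γ l) = ∏ _l : Fin (d + 1), x :=
        Finset.prod_congr rfl fun l _ => max_eq_left ((hγ (Fin.le_last l)).trans hx1.le)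
      have e2 : ∏ _l : Fin (d + 1), x < ∏ l, max x (ε l) :=
        Finset.prod_lt_prod (fun _ _ => hx) (fun _ _ => le_max_left _ _)
          ⟨Fin.last d, Finset.mem_univ _, lt_max_of_lt_right hx2⟩
      have := hγε x hx
      linarith
    have hlast : α (Fin.last d) = β (Fin.last d) :=
      le_antisymm (le_of_not_gt (not_lt β α hβ hβ0 fun x hx => (h x hx).symm))
        (le_of_not_gt (not_lt α β hα hα0 h))
    have hinit : (fun l : Fin d => α l.castSucc) = fun l => β l.castSucc := by
      refine ih _ _ (fun i j hij => hα (Fin.castSucc_le_castSucc_iff.2 hij))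
        (fun i j hij => hβ (Fin.castSucc_le_castSucc_iff.2 hij))
        (fun l => hα0 _) (fun l => hβ0 _) fun x hx => ?_
      have hx' := h x hx
      rw [Fin.prod_univ_castSucc, Fin.prod_univ_castSucc, hlast] at hx'
      exact mul_right_cancel₀ (lt_max_of_lt_left hx).ne' hx'
    funext l
    refine Fin.lastCases hlast (fun i => congrFun hinit i) l

/-- Uniqueness of the tropical factorization. -/
theorem IsTropicalRoots.unique {a : ℕ → ℝ} {d : ℕ} (had : 0 < a d) {α β : Fin d → ℝ}
    (hα : IsTropicalRoots a d α) (hβ : IsTropicalRoots a d β) : α = β := by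
  refine tropicalRoots_unique_aux d α β hα.1 hβ.1 hα.2.1 hβ.2.1 fun x hx => ?_
  have := (hα.2.2 x hx.le).symm.trans (hβ.2.2 x hx.le)
  exact mul_left_cancel₀ had.ne' this

open scoped Classical in
/-- The tropical roots `α_1 ≤ ... ≤ α_d`, extended by `α_0 = 0` and `α_l = ∞` for `l ≥ d + 1`.
The inner condition holds whenever the coefficients are nonnegative and `a d > 0`. -/
noncomputable def tropicalRoot (a : ℕ → ℝ) (d : ℕ) : ℕ → ℝ≥0∞
  | 0 => 0
  | l + 1 =>
    if h : l < d then
      ENNReal.ofReal ((if hα : ∃ α : Fin d → ℝ, IsTropicalRoots a d α then hα.choose else 0) ⟨l, h⟩)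
    else ⊤

/-- Convex hull of the region of all `(j, y)` with `0 ≤ j ≤ d` and `y ≤ log a_j`
(where `log 0 = -∞`); the Newton polygon is its upper boundary. -/
def newtonRegion (a : ℕ → ℝ) (d : ℕ) : Set (ℝ × ℝ) :=
  convexHull ℝ {p | ∃ j : ℕ, j ≤ d ∧ 0 < a j ∧ p.1 = j ∧ p.2 ≤ Real.log (a j)}

/-- `m` is the abscissa of a vertex of the Newton polygon. -/
def IsNewtonVertex (a : ℕ → ℝ) (d m : ℕ) : Prop :=
  ∃ y : ℝ, ((m : ℝ), y) ∈ Set.extremePoints ℝ (newtonRegion a d)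

/-- `k_0 < k_1 < ... < k_q`: the increasing enumeration of the abscissae of the vertices. -/
noncomputable def newtonVertex (a : ℕ → ℝ) (d j : ℕ) : ℕ :=
  Nat.nth (IsNewtonVertex a d) j

/-- The number `q` of edges (there are `q + 1` vertices). -/
noncomputable def newtonEdges (a : ℕ → ℝ) (d : ℕ) : ℕ :=
  {m | IsNewtonVertex a d m}.ncard - 1

/-- The separation parameter `δ_j = α_{k_j} / α_{k_j + 1}`. -/
noncomputable def separation (a : ℕ → ℝ) (d j : ℕ) : ℝ :=
  (tropicalRoot a d (newtonVertex a d j) / tropicalRoot a d (newtonVertex a d j + 1)).toReal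

/-- `E(k) = ((k+1)/k)^k`, and `E(0) = 1`. -/
noncomputable def calE (k : ℕ) : ℝ :=
  if k = 0 then 1 else (((k : ℝ) + 1) / k) ^ k

/-- `U(k, δ)` for `0 ≤ δ ≤ 1`, with `U(k, 1) = ∞`. -/
noncomputable def calU (k : ℕ) (δ : ℝ) : ℝ≥0∞ :=
  ENNReal.ofReal (calE k * (1 + δ + √((k : ℝ) ^ 2 * (1 - δ) ^ 2 + 4 * δ))) / ENNReal.ofReal (1 - δ)

/-- `L_k^{+,prox}`, for `k_{j-1} < k ≤ k_j`. -/
noncomputable def LPlusProx (a : ℕ → ℝ) (d k j : ℕ) : ℝ≥0∞ :=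
  1 / calU (newtonVertex a d j - k) (separation a d j)

/-- `L_k^{-,prox}`, for `k_{j-1} < k ≤ k_j`. -/
noncomputable def LMinusProx (a : ℕ → ℝ) (d k j : ℕ) : ℝ≥0∞ :=
  1 / calU (k - newtonVertex a d (j - 1)) (separation a d (j - 1))

/-- `L_k^{prox}`, for `k_{j-1} < k ≤ k_j`. -/
noncomputable def LProx (a : ℕ → ℝ) (d k j : ℕ) : ℝ≥0∞ :=
  max (LPlusProx a d k j) (LMinusProx a d k j)

/-- `L_k^{+*,prox}`, for `k_{j-1} < k ≤ k_j`. -/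
noncomputable def LPlusStarProx (a : ℕ → ℝ) (d k j : ℕ) : ℝ≥0∞ :=
  1 / calU (newtonVertex a d j - k) (separation a d j ^ 2) ^ (1 / 2 : ℝ)

/-- `L_k^{-*,prox}`, for `k_{j-1} < k ≤ k_j`. -/
noncomputable def LMinusStarProx (a : ℕ → ℝ) (d k j : ℕ) : ℝ≥0∞ :=
  1 / calU (k - newtonVertex a d (j - 1)) (separation a d (j - 1) ^ 2) ^ (1 / 2 : ℝ)

/-- `L_k^{*,prox}`, for `k_{j-1} < k ≤ k_j`. -/
noncomputable def LStarProx (a : ℕ → ℝ) (d k j : ℕ) : ℝ≥0∞ :=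
  max (LPlusStarProx a d k j) (LMinusStarProx a d k j)

/-- The normalized Frobenius norm. -/
noncomputable def normalizedFrobenius {n : ℕ} (M : Matrix (Fin n) (Fin n) ℂ) : ℝ :=
  √((1 / n : ℝ) * ∑ i, ∑ l, ‖M i l‖ ^ 2)

/-- Assumption A1 on a matrix norm: `|det M| ≤ ‖M‖ ^ n`. -/
def AssumptionA1 {n : ℕ} (N : Seminorm ℂ (Matrix (Fin n) (Fin n) ℂ)) : Prop :=
  ∀ M, ‖M.det‖ ≤ N M ^ n

/-- Assumption A2 on a matrix norm: `‖Q M Q'‖_nF ≤ ‖M‖` for some `Q`, `Q'` of determinant one. -/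
def AssumptionA2 {n : ℕ} (N : Seminorm ℂ (Matrix (Fin n) (Fin n) ℂ)) : Prop :=
  ∃ Q Q' : Matrix (Fin n) (Fin n) ℂ, Q.det = 1 ∧ Q'.det = 1 ∧
    ∀ M, normalizedFrobenius (Q * M * Q') ≤ N M

/-- The polynomial `det (A_0 + A_1 X + ... + A_d X^d)`. -/
noncomputable def detPoly {n : ℕ} (A : ℕ → Matrix (Fin n) (Fin n) ℂ) (d : ℕ) : Polynomial ℂ :=
  Matrix.det (∑ j ∈ Finset.range (d + 1),
    (Polynomial.X : Polynomial ℂ) ^ j • (A j).map (Polynomial.C : ℂ →+* Polynomial ℂ))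

/-- The `n d` eigenvalues of a regular matrix polynomial of degree `d`, with multiplicities:
the roots of the determinant, and `∞` with multiplicity `n d - deg det P` (there are infinite
eigenvalues exactly when the leading coefficient is singular). -/
noncomputable def polyEigenvalues {n : ℕ} (A : ℕ → Matrix (Fin n) (Fin n) ℂ) (d : ℕ) :
    Multiset (OnePoint ℂ) :=
  (detPoly A d).roots.map (fun z => (z : OnePoint ℂ)) +
    Multiset.replicate (n * d - (detPoly A d).natDegree) (OnePoint.infty : OnePoint ℂ)

/-- The modulus on `ℂ ∪ {∞}`, with `|∞| = ∞`. -/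
noncomputable def modulus (z : OnePoint ℂ) : ℝ≥0∞ :=
  z.elim ⊤ (fun w => ‖w‖ₑ)

/-- The quotient `|ζ_1 ⋯ ζ_{nk}| / (α_1 ⋯ α_k)^n`, where `ζ_{i+1}` is written `ζ i`. -/
noncomputable def eigenvalueRatio {n d : ℕ} (ζ : Fin (n * d) → OnePoint ℂ) (a : ℕ → ℝ) (k : ℕ) :
    ℝ≥0∞ :=
  (∏ i ∈ Finset.univ.filter (fun i : Fin (n * d) => (i : ℕ) < n * k), modulus (ζ i)) /
    (∏ l ∈ Finset.Icc 1 k, tropicalRoot a d l) ^ n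

/-! Write `a i` for ‖A_i‖, p for det P, and M(r) for the Mahler measure of p(rz). Jensen's formula
gives M(r) = |det A_0| ∏ max(1, r/|ζ|) over all eigenvalues, an infinite one contributing the factor
1. Keeping only nk factors and using max(1, r/|ζ|) ≥ r/|ζ| yields |det A_0| r^(nk) ≤ M(r) |ζ_1 ⋯
ζ_{nk}| for every r > 0. It remains to bound M(r) from above and to choose r.

Upper bound: M(r)^p ≤ (∑ (a i r^i)^p)^n, where from here on p is an exponent, 1 under (A1) and 2
under (A2). The first case is the triangle inequality on the circle. The second combines Hadamard's
inequality, concavity of the logarithm and Parseval's identity.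

Choice of r: the tropical roots satisfy a_i α_1 ⋯ α_i ≤ a_0, so the sum is at most ∑ w_i with w_i =
(a_0 r^i / (α_1 ⋯ α_i))^p, whose consecutive ratios are (r/α_i)^p. The roots are constant between
Newton vertices. With r^p = x α_k^p, m = k_j - k, δ = δ_j^p and 1 < x < 1/δ, the w_i grow by at
least x up to k, by exactly x up to k_j, and then have ratios at most xδ. Summing geometric series
gives ∑ w_i ≤ w_k x^(m+1) (1-δ) / ((x-1)(1-xδ)). Optimizing x gives 1/U(m, δ) up to the estimate x^m
≤ E(m), hence L_k^+ or L_k^{+*}. The choice r^p = α_k^p / x and the reversed sequence give the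
bounds to the left. The carrying lemmas are `norm_det_mul_pow_le_mahlerMeasure_mul_prod`,
`sum_range_mul_le_of_ratios` and `exists_of_lt_invCalU`. -/

/-! ### Mahler measure: upper bound from a circle mean, and Jensen's formula -/

section Mahler

open Polynomial

/-- If `‖p z‖ ^ 2 ≤ G z ^ n` on the unit circle, then the squared Mahler measure of `p` is at most
the `n`-th power of the mean of `G` (Jensen's inequality for the logarithm). -/
theorem mahlerMeasure_sq_le_of_circleAverage_le {p : ℂ[X]} (hp : p ≠ 0) (n : ℕ) {G : ℂ → ℝ}
    (hG : Continuous G) (hG0 : ∀ z, 0 ≤ G z)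
    (h : ∀ z, ‖z‖ = 1 → ‖p.eval z‖ ^ 2 ≤ G z ^ n) {T : ℝ} (hT : 0 < T)
    (hGT : Real.circleAverage G 0 1 ≤ T) : p.mahlerMeasure ^ 2 ≤ T ^ n := by
  have hI : CircleIntegrable G 0 1 := hG.continuousOn.circleIntegrable'
  -- The tangent line of the logarithm at T gives log G ≤ G/T + log T - 1. This continuous majorant
  -- avoids integrating log G, as G may vanish; the factor n/2 comes from the square in `h`.
  set B : ℂ → ℝ := fun z => (n / 2 : ℝ) • (T⁻¹ • G z + (Real.log T - 1)) with hB
  have hBc : Continuous B := by rw [hB]; fun_prop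
  have hBav : Real.circleAverage B 0 1 ≤ n / 2 * Real.log T := by
    have h1 : Real.circleAverage B 0 1
        = (n / 2 : ℝ) * (T⁻¹ * Real.circleAverage G 0 1 + (Real.log T - 1)) := by
      rw [hB, Real.circleAverage_fun_smul, Real.circleAverage_fun_add,
        Real.circleAverage_fun_smul, Real.circleAverage_const]
      · rfl
      · exact (hG.const_smul T⁻¹).continuousOn.circleIntegrable'
      · exact continuous_const.continuousOn.circleIntegrable'
    rw [h1]
    have h2 : T⁻¹ * Real.circleAverage G 0 1 ≤ 1 := by
      rw [inv_mul_le_iff₀ hT]; simpa using hGT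
    have h3 : (0 : ℝ) ≤ n / 2 := by positivity
    exact mul_le_mul_of_nonneg_left (by linarith) h3
  have hle : p.logMahlerMeasure ≤ Real.circleAverage B 0 1 := by
    rw [logMahlerMeasure_def, Real.circleAverage_def, Real.circleAverage_def]
    simp only [smul_eq_mul]
    refine mul_le_mul_of_nonneg_left ?_ (by positivity)
    refine intervalIntegral.integral_mono_ae_restrict (by positivity)
      p.intervalIntegrable_mahlerMeasure
      (by exact (hBc.comp (continuous_circleMap 0 1)).intervalIntegrable _ _) ?_
    rw [Filter.EventuallyLE, Filter.eventually_iff_exists_mem]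
    -- At a zero of p the logarithm takes its default value 0, which B need not dominate. There are
    -- finitely many such angles: `circleMap` is injective on [0, 2π), and the endpoint 2π is
    -- discarded separately.
    refine ⟨{x : ℝ | eval (circleMap 0 1 x) p ≠ 0}, ?_, ?_⟩
    · rw [MeasureTheory.mem_ae_iff, Set.compl_def, MeasureTheory.Measure.restrict_apply' (by simp)]
      apply (Set.Finite.of_sdiff _ <| Set.finite_singleton (2 * Real.pi)).measure_zero
      simp only [ne_eq, Set.mem_ofPred_eq, Decidable.not_not, Set.inter_sdiff_assoc,
        Set.Icc_sdiff_right]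
      rw [Set.ofPred_inter_eq_sep]
      apply Set.Finite.of_finite_image (f := circleMap 0 1)
        ((Multiset.finite_toSet p.roots).subset _)
        <| fun _ h _ k l ↦ injOn_circleMap_of_abs_sub_le' one_ne_zero (by linarith) h.1 k.1 l
      simp [hp]
    · intro x hx
      have hx' : 0 < ‖p.eval (circleMap 0 1 x)‖ := norm_pos_iff.2 hx
      have h1 := h (circleMap 0 1 x) (by simp)
      set z := circleMap 0 1 x
      have h2 : 2 * Real.log ‖p.eval z‖ ≤ n * Real.log (G z) := by
        have := Real.log_le_log (by positivity) h1
        rwa [Real.log_pow, Real.log_pow, Nat.cast_ofNat] at this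
      have h3 : (n : ℝ) * Real.log (G z) ≤ n * (T⁻¹ * G z + (Real.log T - 1)) := by
        rcases (hG0 z).eq_or_lt with h0 | hpos
        · rcases Nat.eq_zero_or_pos n with rfl | hn
          · simp
          · rw [← h0, zero_pow hn.ne'] at h1
            have : 0 < ‖p.eval z‖ ^ 2 := by positivity
            linarith
        · have h4 := Real.log_le_sub_one_of_pos (show 0 < T⁻¹ * G z by positivity)
          rw [Real.log_mul (by positivity) hpos.ne', Real.log_inv] at h4
          exact mul_le_mul_of_nonneg_left (by linarith) (by positivity)
      simp only [hB, smul_eq_mul]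
      linarith
  have hfin : 2 * p.logMahlerMeasure ≤ n * Real.log T := by linarith
  rw [mahlerMeasure, if_pos hp, ← Real.exp_nat_mul, ← Real.exp_log (pow_pos hT n), Real.log_pow]
  exact Real.exp_le_exp.2 (by exact_mod_cast hfin)

/-- Jensen's formula on the circle of radius `r`, for a polynomial without a zero at the origin. -/
theorem mahlerMeasure_comp_C_mul_X (p : ℂ[X]) (h0 : p.eval 0 ≠ 0) {r : ℝ} (hr : 0 < r) :
    (p.comp (C (r : ℂ) * X)).mahlerMeasure
      = ‖p.eval 0‖ * (p.roots.map fun z => max 1 (r / ‖z‖)).prod := by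
  have hroot : ∀ z ∈ p.roots, z ≠ 0 := by
    rintro z hz rfl
    exact h0 (isRoot_of_mem_roots hz)
  have key : ∀ s : Multiset ℂ, (∀ z ∈ s, z ≠ 0) →
      (((s.map fun z => X - C z).prod).comp (C (r : ℂ) * X)).mahlerMeasure
      = ‖((s.map fun z => X - C z).prod).eval 0‖ * (s.map fun z => max 1 (r / ‖z‖)).prod := by
    intro s
    induction s using Multiset.induction_on with
    | empty => simp
    | cons z s ih =>
      intro hs
      have hz : 0 < ‖z‖ := norm_pos_iff.2 (hs z (by simp))
      have h1 : ((X - C z).comp (C (r : ℂ) * X)).mahlerMeasure = ‖z‖ * max 1 (r / ‖z‖) := by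
        have : (X - C z).comp (C (r : ℂ) * X) = C (r : ℂ) * X + C (-z) := by
          simp [sub_eq_add_neg]
        rw [this, mahlerMeasure_C_mul_X_add_C (by exact_mod_cast hr.ne'), norm_neg,
          Complex.norm_real, Real.norm_of_nonneg hr.le, mul_max_of_nonneg _ _ hz.le,
          mul_one, mul_div_cancel₀ _ hz.ne', max_comm]
      simp only [Multiset.map_cons, Multiset.prod_cons, mul_comp, mahlerMeasure_mul, eval_mul,
        norm_mul]
      rw [ih fun w hw => hs w (by simp [hw]), h1]
      simp only [eval_sub, eval_X, eval_C, zero_sub, norm_neg]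
      ring
  have hsplit := (IsAlgClosed.splits p).eq_prod_roots
  set s := p.roots
  rw [hsplit, mul_comp, mahlerMeasure_mul, key s hroot]
  simp [mul_assoc]

end Mahler

/-! ### Evaluation of the determinant polynomial and Hadamard's inequality -/

section Determinant

open Matrix
open scoped ComplexOrder

theorem eval_detPoly {n : ℕ} (A : ℕ → Matrix (Fin n) (Fin n) ℂ) (d : ℕ) (z : ℂ) :
    (detPoly A d).eval z = (∑ j ∈ Finset.range (d + 1), z ^ j • A j).det := by
  rw [detPoly, ← Polynomial.coe_evalRingHom, RingHom.map_det]
  congr 1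
  ext i l
  simp only [Polynomial.coe_evalRingHom, RingHom.mapMatrix_apply, map_apply, Matrix.sum_apply,
    Matrix.smul_apply,
    smul_eq_mul, Polynomial.eval_finsetSum, Polynomial.eval_mul, Polynomial.eval_pow,
    Polynomial.eval_X, Polynomial.eval_C]

theorem eval_zero_detPoly {n : ℕ} (A : ℕ → Matrix (Fin n) (Fin n) ℂ) (d : ℕ) :
    (detPoly A d).eval 0 = (A 0).det := by
  rw [eval_detPoly, Finset.sum_range_succ']
  simp

/-- Hadamard's inequality in the form `|det M| ≤ ‖M‖_nF ^ n`. -/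
theorem norm_det_sq_le_normalizedFrobenius {n : ℕ} (hn : 0 < n) (M : Matrix (Fin n) (Fin n) ℂ) :
    ‖M.det‖ ^ 2 ≤ ((1 / n : ℝ) * ∑ i, ∑ l, ‖M i l‖ ^ 2) ^ n := by
  -- The determinant and trace of Mᴴ M are |det M|² and the squared Frobenius norm, so the claim is
  -- the inequality of arithmetic and geometric means for its eigenvalues.
  have hP : (Mᴴ * M).PosSemidef := posSemidef_conjTranspose_mul_self M
  have hdet : ‖M.det‖ ^ 2 = ∏ i, hP.1.eigenvalues i := by
    have h1 := hP.1.det_eq_prod_eigenvalues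
    rw [det_mul, det_conjTranspose] at h1
    have h2 : star M.det * M.det = ((‖M.det‖ ^ 2 : ℝ) : ℂ) := by
      rw [Complex.star_def, Complex.conj_mul']; push_cast; rfl
    rw [h2] at h1
    have h3 : ((‖M.det‖ ^ 2 : ℝ) : ℂ) = ((∏ i, hP.1.eigenvalues i : ℝ) : ℂ) := by
      rw [h1]; push_cast; rfl
    exact_mod_cast h3
  have htr : ∑ i, ∑ l, ‖M i l‖ ^ 2 = ∑ i, hP.1.eigenvalues i := by
    have h1 := hP.1.trace_eq_sum_eigenvalues
    have h2 : (Mᴴ * M).trace = ((∑ i, ∑ l, ‖M i l‖ ^ 2 : ℝ) : ℂ) := by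
      rw [Finset.sum_comm]
      simp only [Matrix.trace, diag_apply, mul_apply, conjTranspose_apply, Complex.star_def,
        Complex.conj_mul']
      push_cast
      rfl
    rw [h2] at h1
    have h3 : ((∑ i, ∑ l, ‖M i l‖ ^ 2 : ℝ) : ℂ) = ((∑ i, hP.1.eigenvalues i : ℝ) : ℂ) := by
      rw [h1]; push_cast; rfl
    exact_mod_cast h3
  have hn' : (n : ℝ) ≠ 0 := by positivity
  have hamgm := Real.geom_mean_le_arith_mean_weighted Finset.univ (fun _ : Fin n => (1 / n : ℝ))
    hP.1.eigenvalues (fun _ _ => by positivity) (by simp [hn']) (fun i _ => hP.eigenvalues_nonneg i)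
  rw [← Finset.mul_sum, ← htr] at hamgm
  have hprod0 : ∀ i, 0 ≤ hP.1.eigenvalues i := hP.eigenvalues_nonneg
  calc ‖M.det‖ ^ 2 = (∏ i, hP.1.eigenvalues i ^ (1 / n : ℝ)) ^ n := by
        rw [hdet, ← Finset.prod_pow]
        refine Finset.prod_congr rfl fun i _ => ?_
        rw [one_div, Real.rpow_inv_natCast_pow (hprod0 i) hn.ne']
    _ ≤ _ := pow_le_pow_left₀ (Finset.prod_nonneg fun i _ => Real.rpow_nonneg (hprod0 i) _) hamgm n

end Determinant

/-! ### Upper and lower bounds for the Mahler measure of det P(rz) -/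

section Bounds

open Polynomial

variable {n : ℕ}

theorem comp_C_mul_X_ne_zero {A : ℕ → Matrix (Fin n) (Fin n) ℂ} (d : ℕ) (hA0 : (A 0).det ≠ 0)
    (r : ℝ) : (detPoly A d).comp (C (r : ℂ) * X) ≠ 0 := by
  intro h
  apply hA0
  rw [← eval_zero_detPoly A d]
  have := congrArg (eval 0) h
  simpa [eval_comp] using this

/-- On the unit circle the triangle inequality bounds N(P(rz)) by a constant, so the circle-mean
estimate is applied with a constant majorant. -/
theorem mahlerMeasure_le_of_assumptionA1 {N : Seminorm ℂ (Matrix (Fin n) (Fin n) ℂ)}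
    (hN1 : AssumptionA1 N) (A : ℕ → Matrix (Fin n) (Fin n) ℂ) (d : ℕ) (hA0 : (A 0).det ≠ 0)
    (hNA0 : 0 < N (A 0)) {r : ℝ} (hr : 0 < r) :
    ((detPoly A d).comp (C (r : ℂ) * X)).mahlerMeasure
      ≤ (∑ j ∈ Finset.range (d + 1), N (A j) * r ^ j) ^ n := by
  set s := ∑ j ∈ Finset.range (d + 1), N (A j) * r ^ j with hs
  have hs0 : 0 < s := by
    refine Finset.sum_pos' (fun j _ => mul_nonneg (apply_nonneg N _) (by positivity))
      ⟨0, by simp, by simpa using hNA0⟩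
  have hsq := mahlerMeasure_sq_le_of_circleAverage_le (comp_C_mul_X_ne_zero d hA0 r) n
    (G := fun _ => s ^ 2) continuous_const (fun _ => by positivity) ?_ (T := s ^ 2) (by positivity)
    (by rw [Real.circleAverage_const])
  · rw [← pow_mul, mul_comm 2 n, pow_mul] at hsq
    exact le_of_sq_le_sq hsq (by positivity)
  · intro z hz
    rw [← pow_mul, mul_comm 2 n, pow_mul]
    refine pow_le_pow_left₀ (norm_nonneg _) ?_ 2
    rw [eval_comp, eval_detPoly]
    refine (hN1 _).trans (pow_le_pow_left₀ (apply_nonneg N _) ?_ n)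
    refine (Finset.le_sum_of_subadditive N (map_zero N).le (map_add_le_add N) _ _).trans
      (Finset.sum_le_sum fun j _ => ?_)
    rw [map_smul_eq_mul]
    rw [eval_mul, eval_C, eval_X, norm_pow, norm_mul, hz, Complex.norm_real,
      Real.norm_of_nonneg hr.le, mul_one, mul_comm]

/-- Parseval's identity for a polynomial with coefficients `b j`. -/
theorem circleAverage_norm_sum_sq (b : ℕ → ℂ) (d : ℕ) :
    Real.circleAverage (fun z => ‖∑ j ∈ Finset.range (d + 1), z ^ j * b j‖ ^ 2) 0 1
      = ∑ j ∈ Finset.range (d + 1), ‖b j‖ ^ 2 := by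
  set p : ℂ[X] := ∑ j ∈ Finset.range (d + 1), C (b j) * X ^ j with hp
  have hcoeff : ∀ j, p.coeff j = if j < d + 1 then b j else 0 := by
    intro j
    simp [hp, finsetSum_coeff, coeff_C_mul, coeff_X_pow]
  have h1 := p.sum_sq_norm_coeff_eq_circleAverage
  have h2 : ∑ i ∈ p.support, ‖p.coeff i‖ ^ 2 = ∑ j ∈ Finset.range (d + 1), ‖b j‖ ^ 2 := by
    have h3 : p.support ⊆ Finset.range (d + 1) := by
      intro j hj
      rw [mem_support_iff, hcoeff] at hj
      by_contra h
      exact hj (if_neg fun h' => h (Finset.mem_range.2 h'))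
    rw [Finset.sum_subset h3]
    · refine Finset.sum_congr rfl fun j hj => ?_
      rw [hcoeff, if_pos (Finset.mem_range.1 hj)]
    · intro j _ hj
      simp [notMem_support_iff.1 hj]
  rw [← h2, h1]
  congr 1
  ext z
  rw [hp, eval_finsetSum]
  simp only [eval_mul, eval_C, eval_pow, eval_X, mul_comm]

/-- Replacing P by Q P Q' leaves the determinant unchanged. Hadamard's inequality bounds it by the
normalized Frobenius norm, whose squared mean over the circle is computed entry by entry with
Parseval. The cross terms vanish, which is why a sum of squares replaces the square of a sum; (A2)
is then applied to each coefficient. -/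
theorem mahlerMeasure_sq_le_of_assumptionA2 (hn : 0 < n)
    {N : Seminorm ℂ (Matrix (Fin n) (Fin n) ℂ)}
    (hN2 : AssumptionA2 N) (A : ℕ → Matrix (Fin n) (Fin n) ℂ) (d : ℕ) (hA0 : (A 0).det ≠ 0)
    (hNA0 : 0 < N (A 0)) {r : ℝ} (hr : 0 < r) :
    ((detPoly A d).comp (C (r : ℂ) * X)).mahlerMeasure ^ 2
      ≤ (∑ j ∈ Finset.range (d + 1), (N (A j) * r ^ j) ^ 2) ^ n := by
  obtain ⟨Q, Q', hQ, hQ', hle⟩ := hN2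
  set B : ℕ → Matrix (Fin n) (Fin n) ℂ := fun j => (r : ℂ) ^ j • (Q * A j * Q') with hB
  set G : ℂ → ℝ := fun z => (1 / n : ℝ) •
    ∑ i, ∑ l, ‖∑ j ∈ Finset.range (d + 1), z ^ j * B j i l‖ ^ 2 with hG
  have hcont : ∀ i l, Continuous
      fun z : ℂ => ‖∑ j ∈ Finset.range (d + 1), z ^ j * B j i l‖ ^ 2 := by
    intro i l; fun_prop
  have hGc : Continuous G := by rw [hG]; fun_prop
  refine mahlerMeasure_sq_le_of_circleAverage_le (comp_C_mul_X_ne_zero d hA0 r) n hGc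
    (fun z => by simp only [hG, smul_eq_mul]; positivity) ?_ ?_ ?_
  · intro z hz
    have h1 : eval z ((detPoly A d).comp (C (r : ℂ) * X))
        = (∑ j ∈ Finset.range (d + 1), z ^ j • B j).det := by
      rw [eval_comp, eval_detPoly]
      have : ∑ j ∈ Finset.range (d + 1), z ^ j • B j
          = Q * (∑ j ∈ Finset.range (d + 1), (eval z (C (r : ℂ) * X)) ^ j • A j) * Q' := by
        rw [Finset.mul_sum, Finset.sum_mul]
        refine Finset.sum_congr rfl fun j _ => ?_
        rw [hB, eval_mul, eval_C, eval_X, mul_pow, Matrix.mul_smul, Matrix.smul_mul, smul_smul,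
          mul_comm (z ^ j)]
      rw [this, Matrix.det_mul, Matrix.det_mul, hQ, hQ', one_mul, mul_one]
    rw [h1]
    have h2 := norm_det_sq_le_normalizedFrobenius hn (∑ j ∈ Finset.range (d + 1), z ^ j • B j)
    simpa [hG, Matrix.sum_apply] using h2
  · refine Finset.sum_pos' (fun j _ => by positivity)
      ⟨0, by simp, by simpa using pow_pos hNA0 2⟩
  · rw [hG, Real.circleAverage_fun_smul, Real.circleAverage_fun_sum]
    · simp_rw [Real.circleAverage_fun_sum fun l _ => (hcont _ l).continuousOn.circleIntegrable',
        circleAverage_norm_sum_sq]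
      rw [smul_eq_mul, Finset.mul_sum]
      simp_rw [Finset.sum_comm (s := (Finset.univ : Finset (Fin n))) (t := Finset.range (d + 1))]
      rw [← Finset.mul_sum, Finset.sum_comm, Finset.mul_sum]
      refine Finset.sum_le_sum fun j _ => ?_
      have h1 := pow_le_pow_left₀ (Real.sqrt_nonneg _) (hle (A j)) 2
      rw [Real.sq_sqrt (by positivity)] at h1
      rw [mul_pow]
      calc (1 / n : ℝ) * ∑ i, ∑ l, ‖B j i l‖ ^ 2
          = ((1 / n : ℝ) * ∑ i, ∑ l, ‖(Q * A j * Q') i l‖ ^ 2) * (r ^ j) ^ 2 := by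
            rw [mul_assoc, Finset.sum_mul]
            simp_rw [Finset.sum_mul]
            simp [hB, mul_pow, abs_of_pos hr, mul_comm]
        _ ≤ _ := by gcongr
    · intro i _
      exact (continuous_finsetSum _ fun l _ => hcont i l).continuousOn.circleIntegrable'

theorem polyEigenvalues_eq (A : ℕ → Matrix (Fin n) (Fin n) ℂ) (d : ℕ) :
    polyEigenvalues A d = (detPoly A d).roots.map (OnePoint.some : ℂ → OnePoint ℂ) +
      Multiset.replicate (n * d - (detPoly A d).natDegree) (OnePoint.infty : OnePoint ℂ) := by
  simp [polyEigenvalues, Multiset.bind_def, Multiset.pure_def, Multiset.bind_singleton]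

/-- Jensen's formula bounds the product of any `m` eigenvalues from below. -/
theorem norm_det_mul_pow_le_mahlerMeasure_mul_prod {A : ℕ → Matrix (Fin n) (Fin n) ℂ} {d : ℕ}
    (hA0 : (A 0).det ≠ 0) {ζ : Fin (n * d) → OnePoint ℂ}
    (hζ : Multiset.map ζ Finset.univ.val = polyEigenvalues A d) (S : Finset (Fin (n * d)))
    {r : ℝ} (hr : 0 < r) :
    ENNReal.ofReal (‖(A 0).det‖ * r ^ S.card)
      ≤ ENNReal.ofReal ((detPoly A d).comp (C (r : ℂ) * X)).mahlerMeasure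
        * ∏ i ∈ S, modulus (ζ i) := by
  -- The factor of Jensen's formula attached to one eigenvalue. It equals 1 at ∞, so padding the
  -- roots with infinite eigenvalues does not change the product.
  set g : OnePoint ℂ → ℝ≥0∞ := fun z => max 1 (ENNReal.ofReal r / modulus z) with hg
  have h0 : (detPoly A d).eval 0 ≠ 0 := by rwa [eval_zero_detPoly]
  have hroot : ∀ z ∈ (detPoly A d).roots, z ≠ 0 := by
    rintro z hz rfl
    exact h0 (isRoot_of_mem_roots hz)
  have hgfin : ∀ z : ℂ, z ≠ 0 → g z = ENNReal.ofReal (max 1 (r / ‖z‖)) := by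
    intro z hz
    have : modulus (z : OnePoint ℂ) = ENNReal.ofReal ‖z‖ := (ofReal_norm z).symm
    simp only [hg]
    rw [this, ← ENNReal.ofReal_div_of_pos (norm_pos_iff.2 hz), ENNReal.ofReal_max,
      ENNReal.ofReal_one]
  have hginf : g OnePoint.infty = 1 := by
    have : modulus OnePoint.infty = ⊤ := rfl
    simp [hg, this]
  have hprod : ∏ i, g (ζ i)
      = ENNReal.ofReal ((detPoly A d).roots.map fun z => max 1 (r / ‖z‖)).prod := by
    have h1 : ∏ i, g (ζ i) = ((Multiset.map ζ Finset.univ.val).map g).prod := by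
      rw [Multiset.map_map]; rfl
    rw [h1, hζ, polyEigenvalues_eq, Multiset.map_add, Multiset.prod_add, Multiset.map_replicate,
      hginf, Multiset.prod_replicate, one_pow, mul_one, Multiset.map_map]
    generalize (detPoly A d).roots = s at hroot
    induction s using Multiset.induction_on with
    | empty => simp
    | cons z s ih =>
      rw [Multiset.map_cons, Multiset.prod_cons, Multiset.map_cons, Multiset.prod_cons,
        ih fun w hw => hroot w (Multiset.mem_cons_of_mem hw), ENNReal.ofReal_mul (by positivity)]
      congr 1
      exact hgfin z (hroot z (Multiset.mem_cons_self z s))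
  have hpt : ∀ i, ENNReal.ofReal r ≤ g (ζ i) * modulus (ζ i) := by
    intro i
    have hmem : ζ i ∈ polyEigenvalues A d := by
      rw [← hζ]; exact Multiset.mem_map_of_mem ζ (Finset.mem_univ i)
    rw [polyEigenvalues_eq, Multiset.mem_add] at hmem
    rcases hmem with h | h
    · obtain ⟨z, hz, hzi⟩ := Multiset.mem_map.1 h
      have : modulus (ζ i) = ENNReal.ofReal ‖z‖ := by
        rw [← hzi]; exact (ofReal_norm z).symm
      have hz0 : 0 < ‖z‖ := norm_pos_iff.2 (hroot z hz)
      rw [this, ← hzi, hgfin z (hroot z hz), ← ENNReal.ofReal_mul (by positivity)]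
      refine ENNReal.ofReal_le_ofReal ?_
      calc r = r / ‖z‖ * ‖z‖ := by field_simp
        _ ≤ _ := by gcongr; exact le_max_right _ _
    · rw [Multiset.eq_of_mem_replicate h, hginf, one_mul]
      exact le_top
  calc ENNReal.ofReal (‖(A 0).det‖ * r ^ S.card)
      = ENNReal.ofReal ‖(A 0).det‖ * ∏ _i ∈ S, ENNReal.ofReal r := by
        rw [ENNReal.ofReal_mul (norm_nonneg _), Finset.prod_const, ENNReal.ofReal_pow hr.le]
    _ ≤ ENNReal.ofReal ‖(A 0).det‖ * ∏ i ∈ S, (g (ζ i) * modulus (ζ i)) := by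
        gcongr with i
        exact hpt i
    -- All factors of Jensen's formula are at least 1, so the product over S is at most the full
    -- one.
    _ ≤ ENNReal.ofReal ‖(A 0).det‖ * ((∏ i, g (ζ i)) * ∏ i ∈ S, modulus (ζ i)) := by
        rw [Finset.prod_mul_distrib]
        gcongr ENNReal.ofReal ‖(A 0).det‖ * (?_ * _)
        exact Finset.prod_le_prod_of_subset_of_one_le' (Finset.subset_univ S)
          fun i _ _ => le_max_left 1 (ENNReal.ofReal r / modulus (ζ i))
    _ = _ := by
        rw [hprod, mahlerMeasure_comp_C_mul_X _ h0 hr, ENNReal.ofReal_mul (norm_nonneg _),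
          eval_zero_detPoly, mul_assoc]

end Bounds

/-! ### Tropical roots and the Newton polygon -/

section TropicalRoots

/-- Passage to a real sequence indexed from 0 and continued past d - 1 by its last value, so that it
is monotone on all of ℕ. A zero root would make the tropical polynomial vanish at 0, where its value
is `a 0 > 0`. -/
theorem exists_real_tropicalRoot {a : ℕ → ℝ} {d : ℕ} (ha : ∀ j, 0 ≤ a j) (hd : 1 ≤ d)
    (ha0 : 0 < a 0) (had : 0 < a d) :
    ∃ β : ℕ → ℝ, Monotone β ∧ (∀ l, 0 < β l) ∧
      (∀ l < d, tropicalRoot a d (l + 1) = ENNReal.ofReal (β l)) ∧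
      ∀ x : ℝ, 0 ≤ x → tropPoly a d x = a d * ∏ l ∈ Finset.range d, max x (β l) := by
  have hex := exists_isTropicalRoots a ha d had
  obtain ⟨hm, h0, hf⟩ := hex.choose_spec
  set α := hex.choose with hα
  have hlt : ∀ l, min l (d - 1) < d := fun l => by omega
  have hval : ∀ l (hl : l < d), α ⟨min l (d - 1), hlt l⟩ = α ⟨l, hl⟩ := by
    intro l hl
    congr 2
    omega
  have hprod : ∀ x : ℝ, ∏ l ∈ Finset.range d, max x (α ⟨min l (d - 1), hlt l⟩)
      = ∏ l, max x (α l) := by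
    intro x
    rw [← Fin.prod_univ_eq_prod_range (fun l => max x (α ⟨min l (d - 1), hlt l⟩)) d]
    exact Finset.prod_congr rfl fun l _ => by rw [hval l l.2]
  have hz : tropPoly a d 0 = a 0 := by
    refine tropPoly_eq_iff.2 ⟨fun j _ => ?_, 0, Nat.zero_le d, by simp⟩
    rcases Nat.eq_zero_or_pos j with rfl | hj
    · simp
    · simp [hj.ne', ha0.le]
  have hpos : ∀ l, 0 < α l := by
    intro l
    refine (h0 l).lt_of_ne fun hl => ha0.ne' ?_
    rw [← hz, hf 0 le_rfl, Finset.prod_eq_zero (Finset.mem_univ l) (by rw [← hl, max_self]),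
      mul_zero]
  refine ⟨fun l => α ⟨min l (d - 1), hlt l⟩, fun i j hij => hm ?_, fun l => hpos _, ?_, ?_⟩
  · rw [Fin.mk_le_mk]
    omega
  · intro l hl
    simp only [tropicalRoot, dif_pos hl, dif_pos hex]
    rw [hval l hl]
  · intro x hx
    rw [hf x hx, hprod]

variable {a : ℕ → ℝ} {d : ℕ} {β : ℕ → ℝ}

/-- Between two successive roots the factorization is a single monomial a_d x^k ∏_{l ≥ k} β_l. Its
constant is expressed through a_0 = a_d ∏ β_l, the value at 0. -/
theorem tropPoly_mul_prod_eq (ha : ∀ j, 0 ≤ a j)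
    (hβ0 : ∀ l, 0 < β l)
    (hβ : ∀ x : ℝ, 0 ≤ x → tropPoly a d x = a d * ∏ l ∈ Finset.range d, max x (β l))
    {k : ℕ} (hk : k ≤ d) {x : ℝ} (hx : 0 ≤ x) (h1 : ∀ l < k, β l ≤ x)
    (h2 : ∀ l, k ≤ l → l < d → x ≤ β l) :
    tropPoly a d x * ∏ l ∈ Finset.range k, β l = a 0 * x ^ k := by
  have hz : tropPoly a d 0 = a 0 := by
    refine tropPoly_eq_iff.2 ⟨fun j _ => ?_, 0, Nat.zero_le d, by simp⟩
    rcases Nat.eq_zero_or_pos j with rfl | hj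
    · simp
    · simp [hj.ne', ha 0]
  have h3 : ∏ l ∈ Finset.range d, max x (β l) = x ^ k * ∏ l ∈ Finset.Ico k d, β l := by
    rw [← Finset.prod_range_mul_prod_Ico _ hk]
    congr 1
    · rw [Finset.prod_congr rfl fun l hl => max_eq_left (h1 l (Finset.mem_range.1 hl))]
      simp
    · exact Finset.prod_congr rfl fun l hl =>
        max_eq_right (h2 l (Finset.mem_Ico.1 hl).1 (Finset.mem_Ico.1 hl).2)
  have h4 : a 0 = a d * ∏ l ∈ Finset.range d, β l := by
    rw [← hz, hβ 0 le_rfl, Finset.prod_congr rfl fun l _ => max_eq_right (hβ0 l).le]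
  rw [hβ x hx, h3, h4, ← Finset.prod_range_mul_prod_Ico _ hk]
  ring

/-- The log-coefficients lie under the Newton polygon: the i-th monomial is compared with the
tropical polynomial at its i-th root, where the latter is known explicitly. -/
theorem coeff_mul_prod_tropicalRoots_le (ha : ∀ j, 0 ≤ a j) (hβm : Monotone β)
    (hβ0 : ∀ l, 0 < β l)
    (hβ : ∀ x : ℝ, 0 ≤ x → tropPoly a d x = a d * ∏ l ∈ Finset.range d, max x (β l))
    {i : ℕ} (hi : i ≤ d) : a i * ∏ l ∈ Finset.range i, β l ≤ a 0 := by
  rcases i with _ | i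
  · simp
  have h1 := tropPoly_mul_prod_eq ha hβ0 hβ hi (hβ0 i).le (fun l hl => hβm (by omega))
    (fun l hl _ => hβm (by omega))
  have h2 : a (i + 1) * β i ^ (i + 1) ≤ tropPoly a d (β i) := (tropPoly_eq_iff.1 rfl).1 _ hi
  have hx : 0 < β i ^ (i + 1) := pow_pos (hβ0 i) _
  have hP : 0 < ∏ l ∈ Finset.range (i + 1), β l := Finset.prod_pos fun l _ => hβ0 l
  have h3 := mul_le_mul_of_nonneg_right h2 hP.le
  rw [h1] at h3
  refine le_of_mul_le_mul_right ?_ hx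
  linarith

/-- The functional (s, y) ↦ s log r + y attains its maximum over the region only at (m, log a_m),
which is thus an exposed point. The set T, that point together with an open half-plane, is convex
and contains the generators, hence the hull. -/
theorem isNewtonVertex_of_strict_max {m : ℕ} (hm : m ≤ d) (ham : 0 < a m) {r : ℝ} (hr : 0 < r)
    (h : ∀ j ≤ d, j ≠ m → a j * r ^ j < a m * r ^ m) : IsNewtonVertex a d m := by
  set v : ℝ × ℝ := ((m : ℝ), Real.log (a m)) with hv
  set φ : ℝ × ℝ → ℝ := fun p => p.1 * Real.log r + p.2 with hφ
  set T : Set (ℝ × ℝ) := {p | p = v ∨ φ p < φ v} with hT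
  have hφadd : ∀ (s t : ℝ) (p q : ℝ × ℝ), φ (s • p + t • q) = s * φ p + t * φ q := by
    intro s t p q
    simp [hφ]
    ring
  have hTle : ∀ p ∈ T, φ p ≤ φ v := by
    rintro p (rfl | hp)
    · exact le_rfl
    · exact hp.le
  have hTlt : ∀ p ∈ T, ∀ q ∈ T, ∀ s t : ℝ, 0 < s → 0 < t → s + t = 1 →
      (p = v ∧ q = v) ∨ φ (s • p + t • q) < φ v := by
    intro p hp q hq s t hs ht hst
    have e : φ v = s * φ v + t * φ v := by rw [← add_mul, hst, one_mul]
    rw [hφadd]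
    have hp' := mul_le_mul_of_nonneg_left (hTle p hp) hs.le
    have hq' := mul_le_mul_of_nonneg_left (hTle q hq) ht.le
    rcases hp with rfl | hp
    · rcases hq with rfl | hq
      · exact Or.inl ⟨rfl, rfl⟩
      · right
        have := mul_lt_mul_of_pos_left hq ht
        linarith
    · right
      have := mul_lt_mul_of_pos_left hp hs
      linarith
  have hconv : Convex ℝ T := by
    rw [convex_iff_forall_pos]
    intro p hp q hq s t hs ht hst
    rcases hTlt p hp q hq s t hs ht hst with ⟨rfl, rfl⟩ | hlt
    · left
      rw [← add_smul, hst, one_smul]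
    · exact Or.inr hlt
  have hsub : newtonRegion a d ⊆ T := by
    refine convexHull_min ?_ hconv
    rintro p ⟨j, hj, haj, h1, h2⟩
    by_cases hjm : j = m
    · subst hjm
      rcases h2.lt_or_eq with h2 | h2
      · right
        simp only [hφ, hv, h1]
        linarith
      · left
        exact Prod.ext h1 h2
    · right
      have h3 := Real.log_lt_log (by positivity) (h j hj hjm)
      rw [Real.log_mul haj.ne' (by positivity), Real.log_mul ham.ne' (by positivity),
        Real.log_pow, Real.log_pow] at h3
      simp only [hφ, hv, h1]
      linarith
  refine ⟨Real.log (a m), ?_⟩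
  rw [mem_extremePoints]
  refine ⟨subset_convexHull ℝ _ ⟨m, hm, ham, rfl, le_rfl⟩, ?_⟩
  rintro p hp q hq ⟨s, t, hs, ht, hst, hpq⟩
  rcases hTlt p (hsub hp) q (hsub hq) s t hs ht hst with h1 | h1
  · exact h1
  · rw [hpq] at h1
    exact absurd h1 (lt_irrefl _)

theorem IsNewtonVertex.le {m : ℕ} (h : IsNewtonVertex a d m) : m ≤ d := by
  obtain ⟨y, hy⟩ := h
  obtain ⟨j, hj, -, h1, -⟩ := extremePoints_convexHull_subset hy
  have : m = j := Nat.cast_injective (R := ℝ) h1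
  omega

/-- On [u, v] the tropical polynomial equals a constant times x^k. Another monomial touching it at
an interior point r would have to stay below it at both u and v, impossible for an exponent
different from k. Hence the k-th monomial is the strict maximum at r. -/
theorem isNewtonVertex_of_gap (ha : ∀ j, 0 ≤ a j) (ha0 : 0 < a 0) (hβ0 : ∀ l, 0 < β l)
    (hβ : ∀ x : ℝ, 0 ≤ x → tropPoly a d x = a d * ∏ l ∈ Finset.range d, max x (β l))
    {k : ℕ} (hk : k ≤ d) {u v : ℝ} (hu : 0 < u) (huv : u < v) (h1 : ∀ l < k, β l ≤ u)
    (h2 : ∀ l, k ≤ l → l < d → v ≤ β l) : IsNewtonVertex a d k := by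
  obtain ⟨r, hur, hrv⟩ := exists_between huv
  have hr : 0 < r := hu.trans hur
  have hP : 0 < ∏ l ∈ Finset.range k, β l := Finset.prod_pos fun l _ => hβ0 l
  set P := ∏ l ∈ Finset.range k, β l with hPdef
  have hT : ∀ x, u ≤ x → x ≤ v → tropPoly a d x * P = a 0 * x ^ k := fun x hx1 hx2 =>
    tropPoly_mul_prod_eq ha hβ0 hβ hk (hu.le.trans hx1) (fun l hl => (h1 l hl).trans hx1)
      (fun l hl hl' => hx2.trans (h2 l hl hl'))
  have hle : ∀ x, u ≤ x → x ≤ v → ∀ j ≤ d, a j * x ^ j * P ≤ a 0 * x ^ k := by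
    intro x hx1 hx2 j hj
    rw [← hT x hx1 hx2]
    exact mul_le_mul_of_nonneg_right ((tropPoly_eq_iff.1 rfl).1 j hj) hP.le
  have hne : ∀ j ≤ d, j ≠ k → a j * r ^ j ≠ tropPoly a d r := by
    intro j hj hjk heq
    have e1 : a j * r ^ j * P = a 0 * r ^ k := by rw [heq, hT r hur.le hrv.le]
    have hstep : ∀ x, 0 < x → a j * x ^ j * P ≤ a 0 * x ^ k → (x / r) ^ j ≤ (x / r) ^ k := by
      intro x hx hle
      have hd : 0 < a 0 * r ^ k := by positivity
      rw [div_pow, div_pow, div_le_div_iff₀ (by positivity) (by positivity)]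
      refine le_of_mul_le_mul_left ?_ ha0
      have hrj : (0 : ℝ) ≤ r ^ j := by positivity
      have := mul_le_mul_of_nonneg_right hle hrj
      calc a 0 * (x ^ j * r ^ k) = (a 0 * r ^ k) * x ^ j := by ring
        _ = a j * x ^ j * P * r ^ j := by rw [← e1]; ring
        _ ≤ a 0 * (x ^ k * r ^ j) := by linarith
    rcases Nat.lt_or_gt_of_ne hjk with hlt | hgt
    · have h3 := hstep u hu (hle u le_rfl huv.le j hj)
      have h4 := pow_lt_pow_right_of_lt_one₀ (div_pos hu hr) ((div_lt_one hr).2 hur) hlt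
      linarith
    · have h3 := hstep v (hu.trans huv) (hle v huv.le le_rfl j hj)
      have h4 := pow_lt_pow_right₀ ((one_lt_div hr).2 hrv) hgt
      linarith
  obtain ⟨hmax, j, hj, hjeq⟩ := tropPoly_eq_iff.1 (rfl : tropPoly a d r = tropPoly a d r)
  obtain rfl : j = k := by
    by_contra hjk
    exact hne j hj hjk hjeq
  refine isNewtonVertex_of_strict_max hk ?_ hr fun i hi hij => ?_
  · refine (ha j).lt_of_ne fun h0 => ?_
    have := hT r hur.le hrv.le
    rw [← hjeq, ← h0, zero_mul, zero_mul] at this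
    have : 0 < a 0 * r ^ j := by positivity
    linarith
  · rw [hjeq]
    exact (hmax i hi).lt_of_ne (hne i hi hij)

theorem isNewtonVertex_zero (ha : ∀ j, 0 ≤ a j) (ha0 : 0 < a 0) (hβm : Monotone β)
    (hβ0 : ∀ l, 0 < β l)
    (hβ : ∀ x : ℝ, 0 ≤ x → tropPoly a d x = a d * ∏ l ∈ Finset.range d, max x (β l)) :
    IsNewtonVertex a d 0 :=
  isNewtonVertex_of_gap ha ha0 hβ0 hβ (Nat.zero_le d) (half_pos (hβ0 0)) (half_lt_self (hβ0 0))
    (fun _ hl => absurd hl (Nat.not_lt_zero _)) (fun _ _ _ => hβm (Nat.zero_le _))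

theorem isNewtonVertex_degree (ha : ∀ j, 0 ≤ a j) (ha0 : 0 < a 0) (hβm : Monotone β)
    (hβ0 : ∀ l, 0 < β l)
    (hβ : ∀ x : ℝ, 0 ≤ x → tropPoly a d x = a d * ∏ l ∈ Finset.range d, max x (β l)) :
    IsNewtonVertex a d d :=
  isNewtonVertex_of_gap ha ha0 hβ0 hβ le_rfl (hβ0 d) (lt_add_one (β d))
    (fun _ hl => hβm hl.le) (fun _ hl hl' => absurd hl' (not_lt.2 hl))

theorem isNewtonVertex_of_lt (ha : ∀ j, 0 ≤ a j) (ha0 : 0 < a 0) (hβm : Monotone β)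
    (hβ0 : ∀ l, 0 < β l)
    (hβ : ∀ x : ℝ, 0 ≤ x → tropPoly a d x = a d * ∏ l ∈ Finset.range d, max x (β l))
    {i : ℕ} (hi : i + 1 ≤ d) (hlt : β i < β (i + 1)) : IsNewtonVertex a d (i + 1) :=
  isNewtonVertex_of_gap ha ha0 hβ0 hβ hi (hβ0 i) hlt
    (fun _ hl => hβm (by omega)) (fun _ hl _ => hβm hl)

/-- Between two consecutive vertices of the Newton polygon the tropical roots are constant. -/
theorem tropicalRoots_eq_of_no_vertex (ha : ∀ j, 0 ≤ a j) (ha0 : 0 < a 0) (hβm : Monotone β)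
    (hβ0 : ∀ l, 0 < β l)
    (hβ : ∀ x : ℝ, 0 ≤ x → tropPoly a d x = a d * ∏ l ∈ Finset.range d, max x (β l))
    {K K' : ℕ} (hK' : K' ≤ d) (hno : ∀ m, K < m → m < K' → ¬ IsNewtonVertex a d m)
    {i : ℕ} (hi : K ≤ i) (hi' : i < K') : β i = β K := by
  induction i, hi using Nat.le_induction with
  | base => rfl
  | succ i hi ih =>
    rw [← ih (by omega)]
    refine le_antisymm (not_lt.1 fun hlt => ?_) (hβm (Nat.le_succ i))
    exact hno (i + 1) (by omega) hi' (isNewtonVertex_of_lt ha ha0 hβm hβ0 hβ (by omega) hlt)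

end TropicalRoots

/-! ### Enumeration of a finite set of naturals -/

section Nth

variable {p : ℕ → Prop} {d : ℕ}

theorem finite_setOf_of_le (hle : ∀ m, p m → m ≤ d) : {m | p m}.Finite :=
  (Set.finite_Iic d).subset hle

/-- `Nat.nth` takes the default value 0 past the last element, hence the cardinality bounds here and
below. -/
theorem nth_lt_nth_of_lt_ncard (hle : ∀ m, p m → m ≤ d) {i j : ℕ} (hij : i < j)
    (hj : j < {m | p m}.ncard) : Nat.nth p i < Nat.nth p j := by
  have hf := finite_setOf_of_le hle
  rw [Set.ncard_eq_toFinset_card _ hf] at hj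
  exact Nat.nth_lt_nth_of_lt_card hf hij hj

theorem nth_mem_of_lt_ncard (hle : ∀ m, p m → m ≤ d) {j : ℕ} (hj : j < {m | p m}.ncard) :
    p (Nat.nth p j) := by
  have hf := finite_setOf_of_le hle
  rw [Set.ncard_eq_toFinset_card _ hf] at hj
  exact Nat.nth_mem_of_lt_card hf hj

theorem exists_lt_ncard_nth_eq (hle : ∀ m, p m → m ≤ d) {x : ℕ} (hx : p x) :
    ∃ j < {m | p m}.ncard, Nat.nth p j = x := by
  have hf := finite_setOf_of_le hle
  rw [Set.ncard_eq_toFinset_card _ hf]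
  exact Nat.exists_lt_card_finite_nth_eq hf hx

/-- The index is the least j with k ≤ `Nat.nth p j`. It exists because d is enumerated, and is
positive because the enumeration starts at 0 < k. -/
theorem existsUnique_nth_interval (hle : ∀ m, p m → m ≤ d) (h0 : p 0) (hd : p d) {k : ℕ}
    (hk1 : 1 ≤ k) (hkd : k ≤ d) :
    ∃! j, j ∈ Finset.Icc 1 ({m | p m}.ncard - 1) ∧ Nat.nth p (j - 1) < k ∧ k ≤ Nat.nth p j := by
  classical
  have hz : Nat.nth p 0 = 0 := Nat.nth_zero_of_zero h0
  have hex : ∃ j, j < {m | p m}.ncard ∧ k ≤ Nat.nth p j := by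
    obtain ⟨j, hj, hjd⟩ := exists_lt_ncard_nth_eq hle hd
    exact ⟨j, hj, hjd ▸ hkd⟩
  obtain ⟨hj1, hj2⟩ := Nat.find_spec hex
  have hmin := fun i => Nat.find_min hex (m := i)
  set j := Nat.find hex with hj
  have hjpos : 1 ≤ j := by
    by_contra h
    have : j = 0 := by omega
    rw [this, hz] at hj2
    omega
  refine ⟨j, ⟨Finset.mem_Icc.2 ⟨hjpos, by omega⟩, ?_, hj2⟩, ?_⟩
  · by_contra h
    exact hmin (j - 1) (by omega) ⟨by omega, by omega⟩
  · rintro i ⟨hi, hi1, hi2⟩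
    rw [Finset.mem_Icc] at hi
    have hlast : ∀ s t, s ≤ t → t < {m | p m}.ncard → Nat.nth p s ≤ Nat.nth p t := by
      intro s t hst ht
      rcases hst.eq_or_lt with rfl | h
      · exact le_rfl
      · exact (nth_lt_nth_of_lt_ncard hle h ht).le
    rcases lt_trichotomy i j with h | h | h
    · exact absurd ⟨by omega, hi2⟩ (hmin i h)
    · exact h
    · have := hlast j (i - 1) (by omega) (by omega)
      omega

theorem not_of_nth_between (hle : ∀ m, p m → m ≤ d) {j : ℕ}
    (hj : j ∈ Finset.Icc 1 ({m | p m}.ncard - 1)) {m : ℕ} (h1 : Nat.nth p (j - 1) < m)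
    (h2 : m < Nat.nth p j) : ¬ p m := by
  intro hm
  rw [Finset.mem_Icc] at hj
  obtain ⟨i, hi, rfl⟩ := exists_lt_ncard_nth_eq hle hm
  have hmono : ∀ s t, s ≤ t → t < {m | p m}.ncard → Nat.nth p s ≤ Nat.nth p t := by
    intro s t hst ht
    rcases hst.eq_or_lt with rfl | h
    · exact le_rfl
    · exact (nth_lt_nth_of_lt_ncard hle h ht).le
  rcases Nat.lt_or_ge i j with h | h
  · have := hmono i (j - 1) (by omega) (by omega)
    omega
  · have := hmono j i h hi
    omega

end Nth

/-! ### The constants U(m, δ) -/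

section Constants

theorem one_le_calE (m : ℕ) : 1 ≤ calE m := by
  unfold calE
  split_ifs with h
  · exact le_rfl
  · refine one_le_pow₀ ?_
    have : (0 : ℝ) < m := by positivity
    rw [le_div_iff₀ this]
    linarith

/-- The reciprocal of `U(m, δ)` as a real number (negative for `δ > 1`). -/
noncomputable def invCalU (m : ℕ) (δ : ℝ) : ℝ :=
  (1 - δ) / (calE m * (1 + δ + √((m : ℝ) ^ 2 * (1 - δ) ^ 2 + 4 * δ)))

theorem calU_denominator_pos (m : ℕ) {δ : ℝ} (hδ : 0 ≤ δ) :
    0 < calE m * (1 + δ + √((m : ℝ) ^ 2 * (1 - δ) ^ 2 + 4 * δ)) := by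
  have := one_le_calE m
  positivity

/-- The truncation in `ENNReal.ofReal` turns the nonpositive values at δ ≥ 1 into 0, in agreement
with U(m, 1) = ∞. -/
theorem one_div_calU (m : ℕ) {δ : ℝ} (hδ : 0 ≤ δ) :
    1 / calU m δ = ENNReal.ofReal (invCalU m δ) := by
  have h := calU_denominator_pos m hδ
  rw [calU, invCalU, ENNReal.ofReal_div_of_pos h, one_div, ENNReal.inv_div]
  · exact Or.inl ENNReal.ofReal_ne_top
  · exact Or.inr (ENNReal.ofReal_pos.2 h).ne'

theorem one_div_calU_rpow_half (m : ℕ) {δ : ℝ} (hδ : 0 ≤ δ) :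
    1 / calU m δ ^ (1 / 2 : ℝ) = ENNReal.ofReal (√(invCalU m δ)) := by
  rw [one_div, ← ENNReal.inv_rpow, ← one_div, one_div_calU m hδ]
  rcases le_or_gt 0 (invCalU m δ) with h | h
  · rw [ENNReal.ofReal_rpow_of_nonneg h (by norm_num), Real.sqrt_eq_rpow]
  · rw [ENNReal.ofReal_of_nonpos h.le, Real.sqrt_eq_zero_of_nonpos h.le]
    simp

theorem invCalU_zero {δ : ℝ} (hδ : 0 ≤ δ) : invCalU 0 δ = (1 - √δ) / (1 + √δ) := by
  obtain ⟨s, hs, rfl⟩ : ∃ s : ℝ, 0 ≤ s ∧ s ^ 2 = δ := ⟨√δ, Real.sqrt_nonneg _, Real.sq_sqrt hδ⟩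
  have h1 : √(((0 : ℕ) : ℝ) ^ 2 * (1 - s ^ 2) ^ 2 + 4 * s ^ 2) = 2 * s := by
    rw [show ((0 : ℕ) : ℝ) ^ 2 * (1 - s ^ 2) ^ 2 + 4 * s ^ 2 = (2 * s) ^ 2 by push_cast; ring]
    exact Real.sqrt_sq (by positivity)
  rw [invCalU, h1, Real.sqrt_sq hs, calE, if_pos rfl,
    div_eq_div_iff (by positivity) (by positivity)]
  ring

theorem invCalU_zero_sq {δ : ℝ} (hδ : 0 ≤ δ) : invCalU 0 (δ ^ 2) = (1 - δ) / (1 + δ) := by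
  rw [invCalU_zero (by positivity), Real.sqrt_sq hδ]

/-- For δ < 1, squaring reduces the claim to three comparisons: (1-δ)² ≤ 1-δ², E ≤ E², and 1+δ²+t ≤
(1+δ+s)², where s and t are the square roots for δ and δ². The last follows from t ≤ (1+δ)s. -/
theorem invCalU_le_sqrt (m : ℕ) {δ : ℝ} (hδ : 0 ≤ δ) : invCalU m δ ≤ √(invCalU m (δ ^ 2)) := by
  rcases le_or_gt 1 δ with h1 | h1
  · exact (div_nonpos_of_nonpos_of_nonneg (by linarith) (calU_denominator_pos m hδ).le).trans
      (Real.sqrt_nonneg _)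
  · refine Real.le_sqrt_of_sq_le ?_
    have hE := one_le_calE m
    have hden := calU_denominator_pos m hδ
    have hden2 := calU_denominator_pos m (sq_nonneg δ)
    set E := calE m
    have hq : (0 : ℝ) ≤ (m : ℝ) ^ 2 * (1 - δ) ^ 2 + 4 * δ := by positivity
    have hs : √((m : ℝ) ^ 2 * (1 - δ) ^ 2 + 4 * δ) ^ 2 = (m : ℝ) ^ 2 * (1 - δ) ^ 2 + 4 * δ :=
      Real.sq_sqrt hq
    have ht : √((m : ℝ) ^ 2 * (1 - δ ^ 2) ^ 2 + 4 * δ ^ 2)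
        ≤ (1 + δ) * √((m : ℝ) ^ 2 * (1 - δ) ^ 2 + 4 * δ) := by
      refine Real.sqrt_le_iff.2 ⟨by positivity, ?_⟩
      rw [mul_pow, hs]
      have e : (1 + δ) ^ 2 * ((m : ℝ) ^ 2 * (1 - δ) ^ 2 + 4 * δ)
          = (m : ℝ) ^ 2 * (1 - δ ^ 2) ^ 2 + 4 * δ ^ 2 + 4 * δ * (1 + δ + δ ^ 2) := by ring
      rw [e]
      have : 0 ≤ 4 * δ * (1 + δ + δ ^ 2) := by positivity
      linarith
    simp only [invCalU]
    set s := √((m : ℝ) ^ 2 * (1 - δ) ^ 2 + 4 * δ)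
    set t := √((m : ℝ) ^ 2 * (1 - δ ^ 2) ^ 2 + 4 * δ ^ 2)
    have hs0 : 0 ≤ s := Real.sqrt_nonneg _
    rw [div_pow, div_le_div_iff₀ (by positivity) hden2]
    have h2 : E * (1 + δ ^ 2 + t) ≤ (E * (1 + δ + s)) ^ 2 := by
      have h3 : 1 + δ ^ 2 + t ≤ (1 + δ + s) ^ 2 := by nlinarith
      have h4 : E ≤ E ^ 2 := by nlinarith
      rw [mul_pow]
      exact mul_le_mul h4 h3 (by positivity) (by positivity)
    have h5 : (1 - δ) ^ 2 ≤ 1 - δ ^ 2 := by nlinarith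
    exact mul_le_mul h5 h2 (by positivity) (by nlinarith)

/-- `1 / U(m, δ)` is at most the supremum over `1 < x < 1 / δ` of
`(x - 1) (1 - x δ) / (x ^ (m + 1) (1 - δ))`. -/
theorem exists_of_lt_invCalU {m : ℕ} {δ t : ℝ} (hδ : 0 ≤ δ) (ht : 0 < t) (htU : t < invCalU m δ) :
    δ < 1 ∧ ∃ x : ℝ, 1 < x ∧ x * δ < 1 ∧ t * (x ^ (m + 1) * (1 - δ)) ≤ (x - 1) * (1 - x * δ) := by
  have hδ1 : δ < 1 := by
    by_contra h
    have := div_nonpos_of_nonpos_of_nonneg (a := 1 - δ) (by linarith) (calU_denominator_pos m hδ).le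
    rw [invCalU] at htU
    linarith
  refine ⟨hδ1, ?_⟩
  -- Here the quotient is (x-1)/x, whose supremum 1 is not attained; x = 1/(1-t) gives exactly the
  -- value t.
  by_cases h0 : m = 0 ∧ δ = 0
  · obtain ⟨rfl, rfl⟩ := h0
    have ht1 : t < 1 := by simpa [invCalU_zero] using htU
    refine ⟨(1 - t)⁻¹, (one_lt_inv₀ (by linarith)).2 (by linarith), by simp, le_of_eq ?_⟩
    have h1 : (1 - t) * (1 - t)⁻¹ = 1 := mul_inv_cancel₀ (by linarith)
    linear_combination -h1
  · have hq : (0 : ℝ) ≤ (m : ℝ) ^ 2 * (1 - δ) ^ 2 + 4 * δ := by positivity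
    have hs2 := Real.sq_sqrt hq
    have hden := calU_denominator_pos m hδ
    have hE := one_le_calE m
    rw [invCalU] at htU
    set s := √((m : ℝ) ^ 2 * (1 - δ) ^ 2 + 4 * δ) with hs
    have hs0 : 0 ≤ s := Real.sqrt_nonneg _
    have hm0 : (0 : ℝ) ≤ m := Nat.cast_nonneg m
    have hD : 0 < m * (1 + δ) + s := by
      rcases Nat.eq_zero_or_pos m with hm | hm
      · have : 0 < δ := hδ.lt_of_ne fun h => h0 ⟨hm, h.symm⟩
        have : 0 < s := Real.sqrt_pos.2 (by positivity)
        positivity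
      · positivity
    have hslt : s < m * (1 - δ) + 2 := by
      rw [hs, Real.sqrt_lt' (by nlinarith)]
      nlinarith
    have hsgt : 2 * (m + 1) * δ < m * (1 + δ) + s := by
      rcases lt_or_ge (2 * δ - m * (1 - δ)) 0 with h | h
      · linarith
      · rcases hδ.eq_or_lt with hz | hpos
        · rw [← hz] at hD ⊢
          linarith
        · have : 2 * δ - m * (1 - δ) < s := by
            rw [hs]
            refine Real.lt_sqrt_of_sq_lt ?_
            have : 0 < δ * (1 - δ) * (1 + m) := by
              have : 0 < 1 - δ := by linarith
              positivity
            nlinarith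
          linarith
    have hsge : m * (1 - δ) ≤ s := by
      rw [hs]
      refine Real.le_sqrt_of_sq_le ?_
      nlinarith
    -- The critical point of (x-1)(1-xδ)/x^(m+1): its inverse y is the larger root of (m+1)y² -
    -- m(1+δ)y + (m-1)δ = 0, with discriminant s².
    set x := 2 * (m + 1) / (m * (1 + δ) + s) with hx
    have hx1 : 1 < x := by
      rw [hx, one_lt_div hD]
      linarith
    have hxδ : x * δ < 1 := by
      rw [hx, div_mul_eq_mul_div, div_lt_one hD]
      exact hsgt
    refine ⟨x, hx1, hxδ, ?_⟩
    have hkey : (x - 1) * (1 - x * δ) * (1 + δ + s) = x * (1 - δ) ^ 2 := by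
      rw [hx]
      field_simp
      linear_combination (1 + δ - s) * hs2
    -- Since s ≥ m(1-δ), the critical point satisfies x ≤ (m+1)/m for m ≥ 1.
    have hpow : x ^ m ≤ calE m := by
      rw [calE]
      split_ifs with hm
      · simp [hm]
      · have hm' : (0 : ℝ) < m := by positivity
        refine pow_le_pow_left₀ (by linarith) ?_ m
        rw [hx, div_le_div_iff₀ hD hm']
        nlinarith
    rw [lt_div_iff₀ hden] at htU
    have h1δ : 0 < 1 - δ := by linarith
    have hs1 : 0 < 1 + δ + s := by positivity
    refine le_of_mul_le_mul_right ?_ hs1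
    rw [hkey]
    calc t * (x ^ (m + 1) * (1 - δ)) * (1 + δ + s)
        = x ^ m * (t * (1 + δ + s)) * (x * (1 - δ)) := by ring
      _ ≤ calE m * (t * (1 + δ + s)) * (x * (1 - δ)) := by gcongr
      _ = t * (calE m * (1 + δ + s)) * (x * (1 - δ)) := by ring
      _ ≤ (1 - δ) * (x * (1 - δ)) := by gcongr
      _ = x * (1 - δ) ^ 2 := by ring

end Constants

/-! ### Geometric majorants and the choice of the radius -/

section Sums

/-- Sum of a sequence which grows at least geometrically up to the index `k`, at most
geometrically for `m` more steps, and decays geometrically from there on. -/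
theorem sum_range_mul_le_of_ratios {w : ℕ → ℝ} {k m d : ℕ} (hkm : k + m ≤ d) {x δ : ℝ}
    (hx : 1 < x) (hδ : 0 ≤ δ) (hxδ : x * δ < 1)
    (h1 : ∀ i < k, x * w i ≤ w (i + 1)) (h2 : ∀ i, k ≤ i → i < k + m → w (i + 1) ≤ x * w i)
    (h3 : ∀ i, k + m ≤ i → i < d → w (i + 1) ≤ x * δ * w i) (hw : ∀ i, 0 ≤ w i) :
    (∑ i ∈ Finset.range (d + 1), w i) * ((x - 1) * (1 - x * δ))
      ≤ x ^ (m + 1) * (1 - δ) * w k := by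
  have hx1 : 0 < x - 1 := by linarith
  have hxδ' : 0 < 1 - x * δ := by linarith
  have s1 : ∀ j ≤ k, (∑ i ∈ Finset.range j, w i) * (x - 1) ≤ w j := by
    intro j
    induction j with
    | zero => intro _; simpa using hw 0
    | succ j ih =>
      intro hj
      have := ih (by omega)
      have := h1 j (by omega)
      rw [Finset.sum_range_succ]
      linarith
  have s2 : ∀ t ≤ m, (∑ i ∈ Finset.range (k + t + 1), w i) * (x - 1) ≤ x ^ (t + 1) * w k ∧
      w (k + t) ≤ x ^ t * w k := by
    intro t
    induction t with
    | zero =>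
      intro _
      have := s1 k le_rfl
      rw [add_zero, Finset.sum_range_succ, zero_add, pow_one]
      constructor
      · linarith
      · simp
    | succ t ih =>
      intro ht
      obtain ⟨i1, i2⟩ := ih (by omega)
      have i3 : w (k + (t + 1)) ≤ x ^ (t + 1) * w k := by
        calc w (k + t + 1) ≤ x * w (k + t) := h2 _ (by omega) (by omega)
          _ ≤ x * (x ^ t * w k) := by gcongr
          _ = _ := by ring
      refine ⟨?_, i3⟩
      rw [Finset.sum_range_succ, add_mul]
      have := mul_le_mul_of_nonneg_right i3 hx1.le
      calc _ ≤ x ^ (t + 1) * w k + x ^ (t + 1) * w k * (x - 1) := add_le_add i1 this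
        _ = _ := by ring
  -- The second summand is the geometric bound w xδ/(1-xδ) on the remaining tail, multiplied by
  -- (x-1)(1-xδ). Carrying it along makes the estimate inductive.
  have s3 : ∀ s, k + m + s ≤ d →
      (∑ i ∈ Finset.range (k + m + s + 1), w i) * ((x - 1) * (1 - x * δ))
        + w (k + m + s) * (x * δ) * (x - 1) ≤ x ^ (m + 1) * (1 - δ) * w k := by
    intro s
    induction s with
    | zero =>
      intro _
      obtain ⟨i1, i2⟩ := s2 m le_rfl
      have j1 := mul_le_mul_of_nonneg_right i1 hxδ'.le
      have j2 := mul_le_mul_of_nonneg_right i2 (show 0 ≤ x * δ * (x - 1) by positivity)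
      rw [add_zero]
      calc _ = (∑ i ∈ Finset.range (k + m + 1), w i) * (x - 1) * (1 - x * δ)
            + w (k + m) * (x * δ * (x - 1)) := by ring
        _ ≤ _ := add_le_add j1 j2
        _ = _ := by ring
    | succ s ih =>
      intro hs
      have i1 := ih (by omega)
      have i2 := mul_le_mul_of_nonneg_right (h3 (k + m + s) (by omega) (by omega)) hx1.le
      rw [← add_assoc, Finset.sum_range_succ]
      calc _ = (∑ i ∈ Finset.range (k + m + s + 1), w i) * ((x - 1) * (1 - x * δ))
            + w (k + m + s + 1) * (x - 1) := by ring
        _ ≤ _ := add_le_add_right i2 _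
        _ ≤ _ := by linarith
  have hfin := s3 (d - (k + m)) (by omega)
  rw [show k + m + (d - (k + m)) = d by omega] at hfin
  have : 0 ≤ w d * (x * δ) * (x - 1) := mul_nonneg (mul_nonneg (hw d) (by positivity)) hx1.le
  linarith

variable {a : ℕ → ℝ} {d k p : ℕ} {β : ℕ → ℝ}

/-- The consecutive ratio of the majorant sequence is (r/β_i)^p, written without division. -/
theorem pow_ratio_eq (a₀ : ℝ) (hβ0 : ∀ l, 0 < β l) (r : ℝ) (p i : ℕ) :
    (a₀ * r ^ (i + 1) / ∏ l ∈ Finset.range (i + 1), β l) ^ p * β i ^ p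
      = (a₀ * r ^ i / ∏ l ∈ Finset.range i, β l) ^ p * r ^ p := by
  have hP : 0 < ∏ l ∈ Finset.range i, β l := Finset.prod_pos fun l _ => hβ0 l
  have := hβ0 i
  rw [← mul_pow, ← mul_pow, Finset.prod_range_succ]
  congr 1
  field_simp
  ring

theorem sum_coeff_pow_le (ha : ∀ j, 0 ≤ a j) (hβ0 : ∀ l, 0 < β l)
    (hle : ∀ i ≤ d, a i * ∏ l ∈ Finset.range i, β l ≤ a 0) {r : ℝ} (hr : 0 ≤ r) (p : ℕ) :
    ∑ i ∈ Finset.range (d + 1), (a i * r ^ i) ^ p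
      ≤ ∑ i ∈ Finset.range (d + 1), (a 0 * r ^ i / ∏ l ∈ Finset.range i, β l) ^ p := by
  refine Finset.sum_le_sum fun i hi => ?_
  have hP : 0 < ∏ l ∈ Finset.range i, β l := Finset.prod_pos fun l _ => hβ0 l
  refine pow_le_pow_left₀ (mul_nonneg (ha i) (by positivity)) ?_ p
  rw [le_div_iff₀ hP]
  have := mul_le_mul_of_nonneg_right (hle i (by simpa [Nat.lt_succ_iff] using hi))
    (show 0 ≤ r ^ i by positivity)
  linarith

/-- A radius slightly to the right of the tropical root `α_k`. -/
theorem exists_radius_right (ha : ∀ j, 0 ≤ a j) (hβm : Monotone β)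
    (hβ0 : ∀ l, 0 < β l) (hle : ∀ i ≤ d, a i * ∏ l ∈ Finset.range i, β l ≤ a 0)
    (hp : p ≠ 0) (hk : 1 ≤ k) {m : ℕ} (hkm : k + m ≤ d)
    (hconst : ∀ i, k ≤ i → i < k + m → β i = β (k - 1))
    {δ : ℝ} (hδ : 0 ≤ δ) (hsep : ∀ i, k + m ≤ i → i < d → β (k - 1) ≤ δ * β i)
    {t : ℝ} (ht : 0 < t) (htU : t ^ p < invCalU m (δ ^ p)) :
    ∃ r : ℝ, 0 < r ∧ t ^ p * ∑ i ∈ Finset.range (d + 1), (a i * r ^ i) ^ p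
      ≤ (a 0 * r ^ k / ∏ l ∈ Finset.range k, β l) ^ p := by
  obtain ⟨hδ1, x, hx, hxδ, hxt⟩ := exists_of_lt_invCalU (pow_nonneg hδ p) (pow_pos ht p) htU
  set ρ := β (k - 1) with hρ
  have hρ0 : 0 < ρ := hβ0 _
  have hx0 : 0 < x := by linarith
  -- Chosen so that r^p = x ρ^p: the ratios are at least x before k, equal to x up to k + m, and at
  -- most x δ^p afterwards.
  set r := x ^ ((p : ℝ)⁻¹) * ρ with hrdef
  have hr : 0 < r := mul_pos (Real.rpow_pos_of_pos hx0 _) hρ0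
  have hrp : r ^ p = x * ρ ^ p := by
    rw [hrdef, mul_pow, Real.rpow_inv_natCast_pow hx0.le hp]
  refine ⟨r, hr, ?_⟩
  set w : ℕ → ℝ := fun i => (a 0 * r ^ i / ∏ l ∈ Finset.range i, β l) ^ p with hw
  have hw0 : ∀ i, 0 ≤ w i := fun i => pow_nonneg (div_nonneg (mul_nonneg (ha 0) (by positivity))
    (Finset.prod_nonneg fun l _ => (hβ0 l).le)) p
  have hrec : ∀ i, w (i + 1) * β i ^ p = w i * (x * ρ ^ p) := by
    intro i
    rw [← hrp]
    exact pow_ratio_eq (a 0) hβ0 r p i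
  have hβp : ∀ i, 0 < β i ^ p := fun i => pow_pos (hβ0 i) p
  have hsum := sum_range_mul_le_of_ratios (w := w) hkm hx (pow_nonneg hδ p) hxδ ?_ ?_ ?_ hw0
  · have h1 := mul_le_mul_of_nonneg_left (sum_coeff_pow_le ha hβ0 hle hr.le p) (pow_pos ht p).le
    refine h1.trans ?_
    change t ^ p * ∑ i ∈ Finset.range (d + 1), w i ≤ w k
    have hpos : 0 < (x - 1) * (1 - x * δ ^ p) := mul_pos (by linarith) (by linarith)
    refine le_of_mul_le_mul_right ?_ hpos
    calc _ = t ^ p * ((∑ i ∈ Finset.range (d + 1), w i) * ((x - 1) * (1 - x * δ ^ p))) := by ring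
      _ ≤ t ^ p * (x ^ (m + 1) * (1 - δ ^ p) * w k) := by gcongr
      _ = t ^ p * (x ^ (m + 1) * (1 - δ ^ p)) * w k := by ring
      _ ≤ (x - 1) * (1 - x * δ ^ p) * w k := mul_le_mul_of_nonneg_right hxt (hw0 k)
      _ = _ := by ring
  · intro i hi
    refine le_of_mul_le_mul_right ?_ (hβp i)
    rw [hrec]
    have : β i ^ p ≤ ρ ^ p := pow_le_pow_left₀ (hβ0 i).le (hβm (by omega)) p
    calc x * w i * β i ^ p ≤ x * w i * ρ ^ p :=
          mul_le_mul_of_nonneg_left this (mul_nonneg hx0.le (hw0 i))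
      _ = _ := by ring
  · intro i hi hi'
    refine le_of_mul_le_mul_right ?_ (hβp i)
    rw [hrec, hconst i hi hi']
    exact le_of_eq (by ring)
  · intro i hi hi'
    refine le_of_mul_le_mul_right ?_ (hβp i)
    rw [hrec]
    have : ρ ^ p ≤ δ ^ p * β i ^ p := by
      rw [← mul_pow]
      exact pow_le_pow_left₀ hρ0.le (hsep i hi hi') p
    calc w i * (x * ρ ^ p) ≤ w i * (x * (δ ^ p * β i ^ p)) := by
          have := hw0 i
          gcongr
      _ = _ := by ring

/-- A radius slightly to the left of the tropical root `α_k`. -/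
theorem exists_radius_left (ha : ∀ j, 0 ≤ a j) (hβm : Monotone β)
    (hβ0 : ∀ l, 0 < β l) (hle : ∀ i ≤ d, a i * ∏ l ∈ Finset.range i, β l ≤ a 0)
    (hp : p ≠ 0) (hkd : k ≤ d) {m : ℕ} (hkm : m ≤ k)
    (hconst : ∀ i, k - m ≤ i → i < k → β i = β (k - 1))
    {δ : ℝ} (hδ : 0 ≤ δ) (hsep : ∀ i < k - m, β i ≤ δ * β (k - 1))
    {t : ℝ} (ht : 0 < t) (htU : t ^ p < invCalU m (δ ^ p)) :
    ∃ r : ℝ, 0 < r ∧ t ^ p * ∑ i ∈ Finset.range (d + 1), (a i * r ^ i) ^ p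
      ≤ (a 0 * r ^ k / ∏ l ∈ Finset.range k, β l) ^ p := by
  obtain ⟨hδ1, x, hx, hxδ, hxt⟩ := exists_of_lt_invCalU (pow_nonneg hδ p) (pow_pos ht p) htU
  set ρ := β (k - 1) with hρ
  have hρ0 : 0 < ρ := hβ0 _
  have hx0 : 0 < x := by linarith
  set r := (x⁻¹) ^ ((p : ℝ)⁻¹) * ρ with hrdef
  have hr : 0 < r := mul_pos (Real.rpow_pos_of_pos (by positivity) _) hρ0
  have hrp : r ^ p = x⁻¹ * ρ ^ p := by
    rw [hrdef, mul_pow, Real.rpow_inv_natCast_pow (by positivity) hp]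
  refine ⟨r, hr, ?_⟩
  set w : ℕ → ℝ := fun i => (a 0 * r ^ i / ∏ l ∈ Finset.range i, β l) ^ p with hw
  have hw0 : ∀ i, 0 ≤ w i := fun i => pow_nonneg (div_nonneg (mul_nonneg (ha 0) (by positivity))
    (Finset.prod_nonneg fun l _ => (hβ0 l).le)) p
  have hrec : ∀ i, w i * ρ ^ p = x * w (i + 1) * β i ^ p := by
    intro i
    have h1 : w (i + 1) * β i ^ p = w i * r ^ p := pow_ratio_eq (a 0) hβ0 r p i
    rw [mul_assoc, h1, hrp]
    field_simp
  have hρp : 0 < ρ ^ p := pow_pos hρ0 p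
  have hidx : ∀ i, i < d → d - i = d - (i + 1) + 1 := fun i hi => by omega
  -- With r^p = ρ^p / x the growth conditions hold for the sequence read backwards, with d - k in
  -- the role of k.
  have hsum := sum_range_mul_le_of_ratios (w := fun i => w (d - i)) (k := d - k) (m := m) (d := d)
    (by omega) hx (pow_nonneg hδ p) hxδ ?_ ?_ ?_ (fun i => hw0 _)
  · have hreflect : ∑ i ∈ Finset.range (d + 1), w (d - i) = ∑ i ∈ Finset.range (d + 1), w i := by
      rw [← Finset.sum_range_reflect w (d + 1)]
      rfl
    rw [hreflect, show d - (d - k) = k by omega] at hsum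
    have h1 := mul_le_mul_of_nonneg_left (sum_coeff_pow_le ha hβ0 hle hr.le p) (pow_pos ht p).le
    refine h1.trans ?_
    change t ^ p * ∑ i ∈ Finset.range (d + 1), w i ≤ w k
    have hpos : 0 < (x - 1) * (1 - x * δ ^ p) := mul_pos (by linarith) (by linarith)
    refine le_of_mul_le_mul_right ?_ hpos
    calc _ = t ^ p * ((∑ i ∈ Finset.range (d + 1), w i) * ((x - 1) * (1 - x * δ ^ p))) := by ring
      _ ≤ t ^ p * (x ^ (m + 1) * (1 - δ ^ p) * w k) := by gcongr
      _ = t ^ p * (x ^ (m + 1) * (1 - δ ^ p)) * w k := by ring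
      _ ≤ (x - 1) * (1 - x * δ ^ p) * w k := mul_le_mul_of_nonneg_right hxt (hw0 k)
      _ = _ := by ring
  · intro i hi
    rw [hidx i (by omega)]
    set e := d - (i + 1) with he
    refine le_of_mul_le_mul_right ?_ hρp
    rw [hrec e]
    have : ρ ^ p ≤ β e ^ p := pow_le_pow_left₀ hρ0.le (hβm (by omega)) p
    exact mul_le_mul_of_nonneg_left this (mul_nonneg hx0.le (hw0 _))
  · intro i hi hi'
    rw [hidx i (by omega)]
    set e := d - (i + 1) with he
    refine le_of_mul_le_mul_right ?_ hρp
    rw [hrec e, hconst e (by omega) (by omega)]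
  · intro i hi hi'
    rw [hidx i (by omega)]
    set e := d - (i + 1) with he
    refine le_of_mul_le_mul_right ?_ hρp
    rw [hrec e]
    have : β e ^ p ≤ δ ^ p * ρ ^ p := by
      rw [← mul_pow]
      exact pow_le_pow_left₀ (hβ0 e).le (hsep e (by omega)) p
    calc x * w (e + 1) * β e ^ p ≤ x * w (e + 1) * (δ ^ p * ρ ^ p) :=
          mul_le_mul_of_nonneg_left this (mul_nonneg hx0.le (hw0 _))
      _ = _ := by ring

end Sums

/-! ### Assembly of the eigenvalue bound -/

section Main

theorem prod_tropicalRoot_eq {a : ℕ → ℝ} {d : ℕ} {β : ℕ → ℝ} (hβ0 : ∀ l, 0 < β l)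
    (hroot : ∀ l < d, tropicalRoot a d (l + 1) = ENNReal.ofReal (β l)) {k : ℕ} (hk : k ≤ d) :
    ∏ l ∈ Finset.Icc 1 k, tropicalRoot a d l
      = ENNReal.ofReal (∏ l ∈ Finset.range k, β l) := by
  induction k with
  | zero => simp
  | succ k ih =>
    rw [Finset.prod_Icc_succ_top (by omega), ih (by omega), hroot k (by omega),
      Finset.prod_range_succ, ENNReal.ofReal_mul (Finset.prod_nonneg fun l _ => (hβ0 l).le)]

theorem card_filter_val_lt {M m : ℕ} (h : m ≤ M) :
    (Finset.univ.filter fun i : Fin M => (i : ℕ) < m).card = m := by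
  rw [Fin.card_filter_val_lt, min_eq_right h]

/-- A radius is available only for t strictly below the constant, so the bound at the constant
itself is reached by continuity. A nonpositive constant gives 0 on the left, as n ≠ 0. -/
theorem ofReal_mul_pow_le_of_forall_lt {c lam : ℝ} {n : ℕ} (hn : n ≠ 0) {R : ℝ≥0∞}
    (h : ∀ t, 0 < t → t < lam → ENNReal.ofReal (c * t ^ n) ≤ R) (hc : 0 ≤ c) :
    ENNReal.ofReal c * ENNReal.ofReal lam ^ n ≤ R := by
  rcases le_or_gt lam 0 with hl | hl
  · rw [ENNReal.ofReal_of_nonpos hl, zero_pow hn, mul_zero]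
    exact zero_le
  · rw [← ENNReal.ofReal_pow hl.le, ← ENNReal.ofReal_mul hc]
    have hcont : Continuous fun t : ℝ => ENNReal.ofReal (c * t ^ n) :=
      ENNReal.continuous_ofReal.comp (by fun_prop)
    refine le_of_tendsto (hcont.tendsto lam |>.mono_left nhdsWithin_le_nhds :
      Filter.Tendsto _ (nhdsWithin lam (Set.Iio lam)) _) ?_
    filter_upwards [Ioo_mem_nhdsLT hl] with t ht
    exact h t ht.1 ht.2

/-- The lower bound for one radius, from an upper bound of the Mahler measure. -/
theorem le_eigenvalueRatio_of_radius {n d k p : ℕ} (hp : p ≠ 0)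
    {A : ℕ → Matrix (Fin n) (Fin n) ℂ}
    (hA0 : (A 0).det ≠ 0) {a : ℕ → ℝ} (ha0 : 0 < a 0) (hkd : k ≤ d) {β : ℕ → ℝ}
    (hβ0 : ∀ l, 0 < β l)
    (hroot : ∀ l < d, tropicalRoot a d (l + 1) = ENNReal.ofReal (β l))
    {ζ : Fin (n * d) → OnePoint ℂ}
    (hζ : Multiset.map ζ Finset.univ.val = polyEigenvalues A d)
    {r t : ℝ} (hr : 0 < r) (ht : 0 < t)
    (hM : ((detPoly A d).comp (Polynomial.C (r : ℂ) * Polynomial.X)).mahlerMeasure ^ p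
      ≤ (∑ j ∈ Finset.range (d + 1), (a j * r ^ j) ^ p) ^ n)
    (hsum : t ^ p * ∑ i ∈ Finset.range (d + 1), (a i * r ^ i) ^ p
      ≤ (a 0 * r ^ k / ∏ l ∈ Finset.range k, β l) ^ p)
    (hsum0 : 0 ≤ ∑ i ∈ Finset.range (d + 1), (a i * r ^ i) ^ p) :
    ENNReal.ofReal (‖(A 0).det‖ / a 0 ^ n * t ^ n) ≤ eigenvalueRatio ζ a k := by
  have hP : 0 < ∏ l ∈ Finset.range k, β l := Finset.prod_pos fun l _ => hβ0 l
  have hJ := norm_det_mul_pow_le_mahlerMeasure_mul_prod hA0 hζ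
    (Finset.univ.filter fun i : Fin (n * d) => (i : ℕ) < n * k) hr
  rw [card_filter_val_lt (Nat.mul_le_mul_left n hkd)] at hJ
  rw [eigenvalueRatio, prod_tropicalRoot_eq hβ0 hroot hkd, ← ENNReal.ofReal_pow hP.le]
  set Z := ∏ i ∈ Finset.univ.filter (fun i : Fin (n * d) => (i : ℕ) < n * k), modulus (ζ i)
  set P := ∏ l ∈ Finset.range k, β l
  set M := ((detPoly A d).comp (Polynomial.C (r : ℂ) * Polynomial.X)).mahlerMeasure
  -- The upper bound for the Mahler measure obtained from `hM` and `hsum` after taking p-th roots.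
  -- The powers of r then cancel against r^(nk) from Jensen's formula.
  set u := (a 0 * r ^ k / P / t) ^ n with hu
  have hu0 : 0 < u := by positivity
  have hMu : M ≤ u := by
    have h1 : ∑ i ∈ Finset.range (d + 1), (a i * r ^ i) ^ p ≤ (a 0 * r ^ k / P / t) ^ p := by
      rw [div_pow _ t, le_div_iff₀ (by positivity), mul_comm]
      exact hsum
    have h2 : M ^ p ≤ u ^ p := by
      rw [hu, ← pow_mul, mul_comm n p, pow_mul]
      exact hM.trans (pow_le_pow_left₀ hsum0 h1 n)
    exact le_of_pow_le_pow_left₀ hp hu0.le h2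
  have hPn : ENNReal.ofReal (P ^ n) ≠ 0 := (ENNReal.ofReal_pos.2 (by positivity)).ne'
  rw [ENNReal.le_div_iff_mul_le (Or.inl hPn) (Or.inl ENNReal.ofReal_ne_top),
    ← ENNReal.ofReal_mul (by positivity)]
  have e : ‖(A 0).det‖ / a 0 ^ n * t ^ n * P ^ n = u⁻¹ * (‖(A 0).det‖ * r ^ (n * k)) := by
    rw [hu, mul_comm n k, pow_mul, div_pow, div_pow, mul_pow]
    field_simp
  calc ENNReal.ofReal (‖(A 0).det‖ / a 0 ^ n * t ^ n * P ^ n)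
      = ENNReal.ofReal u⁻¹ * ENNReal.ofReal (‖(A 0).det‖ * r ^ (n * k)) := by
        rw [e, ENNReal.ofReal_mul (by positivity)]
    _ ≤ ENNReal.ofReal u⁻¹ * (ENNReal.ofReal u * Z) := by
        gcongr
        exact hJ.trans (by gcongr)
    _ = Z := by
        rw [← mul_assoc, ← ENNReal.ofReal_mul (by positivity), inv_mul_cancel₀ hu0.ne',
          ENNReal.ofReal_one, one_mul]

theorem separation_nonneg (a : ℕ → ℝ) (d j : ℕ) : 0 ≤ separation a d j := ENNReal.toReal_nonneg

theorem separation_eq {a : ℕ → ℝ} {d : ℕ} {β : ℕ → ℝ} (hβ0 : ∀ l, 0 < β l)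
    (hroot : ∀ l < d, tropicalRoot a d (l + 1) = ENNReal.ofReal (β l)) {j : ℕ}
    (h1 : 1 ≤ newtonVertex a d j) (h2 : newtonVertex a d j < d) :
    separation a d j = β (newtonVertex a d j - 1) / β (newtonVertex a d j) := by
  rw [separation]
  obtain ⟨K, hK⟩ : ∃ K, newtonVertex a d j = K + 1 := ⟨newtonVertex a d j - 1, by omega⟩
  rw [hK] at h2 ⊢
  rw [hroot K (by omega), hroot (K + 1) h2, ← ENNReal.ofReal_div_of_pos (hβ0 _),
    ENNReal.toReal_ofReal (div_nonneg (hβ0 _).le (hβ0 _).le), Nat.add_sub_cancel]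

end Main

theorem corollary4p7 (n d : ℕ) (A : ℕ → Matrix (Fin n) (Fin n) ℂ)
    (N : Seminorm ℂ (Matrix (Fin n) (Fin n) ℂ)) (hN : ∀ M, N M = 0 → M = 0)
    (hA0 : (A 0).det ≠ 0) (hAd : A d ≠ 0)
    (a : ℕ → ℝ) (ha : a = fun j => N (A j))
    (c : ℝ) (hc : c = ‖(A 0).det‖ / N (A 0) ^ n)
    (k : ℕ) (hk1 : 1 ≤ k) (hkd : k ≤ d) :
    (∃! j, j ∈ Finset.Icc 1 (newtonEdges a d) ∧
      newtonVertex a d (j - 1) < k ∧ k ≤ newtonVertex a d j) ∧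
    ∀ j ∈ Finset.Icc 1 (newtonEdges a d),
      newtonVertex a d (j - 1) < k → k ≤ newtonVertex a d j →
      (tropicalRoot a d k = tropicalRoot a d (newtonVertex a d (j - 1) + 1) ∧
        tropicalRoot a d k = tropicalRoot a d (newtonVertex a d j)) ∧
      (AssumptionA1 N → ∀ ζ : Fin (n * d) → OnePoint ℂ,
        Multiset.map ζ Finset.univ.val = polyEigenvalues A d →
        (Monotone fun i => modulus (ζ i)) →
        ENNReal.ofReal c * LProx a d k j ^ n ≤ eigenvalueRatio ζ a k) ∧
      (AssumptionA2 N → ∀ ζ : Fin (n * d) → OnePoint ℂ,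
        Multiset.map ζ Finset.univ.val = polyEigenvalues A d →
        (Monotone fun i => modulus (ζ i)) →
        ENNReal.ofReal c * LStarProx a d k j ^ n ≤ eigenvalueRatio ζ a k) ∧
      LProx a d k j ≤ LStarProx a d k j ∧
      (k = newtonVertex a d j →
        (LPlusProx a d k j ≤ LProx a d k j ∧
          LPlusProx a d k j =
            ENNReal.ofReal ((1 - √(separation a d j)) / (1 + √(separation a d j)))) ∧
        (LPlusStarProx a d k j ≤ LStarProx a d k j ∧
          LPlusStarProx a d k j =
            ENNReal.ofReal (√((1 - separation a d j) / (1 + separation a d j))))) := by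
  have hn : 0 < n := by
    refine Nat.pos_of_ne_zero fun h => hAd ?_
    subst h
    exact Subsingleton.elim _ _
  have haj : ∀ j, a j = N (A j) := fun j => congrFun ha j
  have hapos : ∀ j, A j ≠ 0 → 0 < a j := fun j hj => by
    rw [haj]
    exact (apply_nonneg N _).lt_of_ne fun h => hj (hN _ h.symm)
  have ha_nonneg : ∀ j, 0 ≤ a j := fun j => by rw [haj]; exact apply_nonneg N _
  have ha0 : 0 < a 0 := hapos 0 fun h => hA0 (by
    have : Nonempty (Fin n) := ⟨⟨0, hn⟩⟩
    rw [h, Matrix.det_zero])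
  have hNA0 : 0 < N (A 0) := haj 0 ▸ ha0
  obtain ⟨β, hβm, hβ0, hroot, hβ⟩ :=
    exists_real_tropicalRoot ha_nonneg (hk1.trans hkd) ha0 (hapos d hAd)
  have hVle : ∀ m, IsNewtonVertex a d m → m ≤ d := fun m h => h.le
  have hV0 := isNewtonVertex_zero ha_nonneg ha0 hβm hβ0 hβ
  have hVd := isNewtonVertex_degree ha_nonneg ha0 hβm hβ0 hβ
  have hcoeff : ∀ i ≤ d, a i * ∏ l ∈ Finset.range i, β l ≤ a 0 := fun i hi =>
    coeff_mul_prod_tropicalRoots_le ha_nonneg hβm hβ0 hβ hi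
  refine ⟨existsUnique_nth_interval hVle hV0 hVd hk1 hkd, fun j hj hlt hle => ?_⟩
  have hj' := Finset.mem_Icc.1 hj
  have hVj : newtonVertex a d j ≤ d :=
    hVle _ (nth_mem_of_lt_ncard hVle (by rw [newtonEdges] at hj'; omega))
  have hconst : ∀ i, newtonVertex a d (j - 1) ≤ i → i < newtonVertex a d j →
      β i = β (newtonVertex a d (j - 1)) := fun i hi hi' =>
    tropicalRoots_eq_of_no_vertex ha_nonneg ha0 hβm hβ0 hβ hVj
      (fun m h1 h2 => not_of_nth_between hVle hj h1 h2) hi hi'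
  have hconstk : ∀ i, newtonVertex a d (j - 1) ≤ i → i < newtonVertex a d j →
      β i = β (k - 1) := fun i hi hi' => by
    rw [hconst i hi hi', hconst (k - 1) (by omega) (by omega)]
  have hδ : ∀ i, 0 ≤ separation a d i := separation_nonneg a d
  -- At the last vertex k_j = d the range of i is empty, so the formula for δ_j is needed only at
  -- interior vertices; likewise in `hsep'` when k_{j-1} = 0.
  have hsep : ∀ i, newtonVertex a d j ≤ i → i < d → β (k - 1) ≤ separation a d j * β i := by
    intro i hi hid
    have h1 : 1 ≤ newtonVertex a d j := hk1.trans hle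
    rw [separation_eq hβ0 hroot h1 (by omega), hconstk (newtonVertex a d j - 1) (by omega) (by omega),
      div_mul_eq_mul_div, le_div_iff₀ (hβ0 _)]
    exact mul_le_mul_of_nonneg_left (hβm hi) (hβ0 _).le
  have hsep' : ∀ i < newtonVertex a d (j - 1), β i ≤ separation a d (j - 1) * β (k - 1) := by
    intro i hi
    rw [separation_eq hβ0 hroot (by omega) (by omega), ← hconstk (newtonVertex a d (j - 1)) le_rfl
      (by omega), div_mul_cancel₀ _ (hβ0 _).ne']
    exact hβm (by omega)
  -- One statement serves both assumptions: p = 1 for (A1), p = 2 for (A2). The two alternatives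
  -- match the two terms in the maximum defining L_k or L_k^*.
  have hradius : ∀ (p : ℕ), p ≠ 0 → ∀ t, 0 < t →
      (t ^ p < invCalU (newtonVertex a d j - k) (separation a d j ^ p) ∨
        t ^ p < invCalU (k - newtonVertex a d (j - 1)) (separation a d (j - 1) ^ p)) →
      ∃ r : ℝ, 0 < r ∧ t ^ p * ∑ i ∈ Finset.range (d + 1), (a i * r ^ i) ^ p
        ≤ (a 0 * r ^ k / ∏ l ∈ Finset.range k, β l) ^ p := by
    rintro p hp t ht (htU | htU)
    · exact exists_radius_right ha_nonneg hβm hβ0 hcoeff hp hk1 (by omega)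
        (fun i hi hi' => hconstk i (by omega) (by omega)) (hδ j)
        (fun i hi hid => hsep i (by omega) hid) ht htU
    · exact exists_radius_left ha_nonneg hβm hβ0 hcoeff hp hkd (by omega)
        (fun i hi hi' => hconstk i (by omega) (by omega)) (hδ (j - 1))
        (fun i hi => hsep' i (by omega)) ht htU
  have hbound : ∀ (p : ℕ), p ≠ 0 →
      (∀ r : ℝ, 0 < r →
        ((detPoly A d).comp (Polynomial.C (r : ℂ) * Polynomial.X)).mahlerMeasure ^ p
          ≤ (∑ i ∈ Finset.range (d + 1), (a i * r ^ i) ^ p) ^ n) →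
      ∀ ζ : Fin (n * d) → OnePoint ℂ, Multiset.map ζ Finset.univ.val = polyEigenvalues A d →
      ∀ t, 0 < t →
        (t ^ p < invCalU (newtonVertex a d j - k) (separation a d j ^ p) ∨
          t ^ p < invCalU (k - newtonVertex a d (j - 1)) (separation a d (j - 1) ^ p)) →
        ENNReal.ofReal (c * t ^ n) ≤ eigenvalueRatio ζ a k := by
    intro p hp hM ζ hζ t ht htU
    obtain ⟨r, hr, hsum⟩ := hradius p hp t ht htU
    have := le_eigenvalueRatio_of_radius hp hA0 ha0 hkd hβ0 hroot hζ hr ht (hM r hr) hsum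
      (Finset.sum_nonneg fun i _ => pow_nonneg (mul_nonneg (ha_nonneg i) (by positivity)) p)
    rwa [hc, ← haj]
  have hc0 : 0 ≤ c := by rw [hc]; positivity
  have hL : LProx a d k j = ENNReal.ofReal
      (max (invCalU (newtonVertex a d j - k) (separation a d j))
        (invCalU (k - newtonVertex a d (j - 1)) (separation a d (j - 1)))) := by
    rw [LProx, LPlusProx, LMinusProx, one_div_calU _ (hδ _), one_div_calU _ (hδ _),
      ENNReal.ofReal_max]
  have hLs : LStarProx a d k j = ENNReal.ofReal
      (max (√(invCalU (newtonVertex a d j - k) (separation a d j ^ 2)))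
        (√(invCalU (k - newtonVertex a d (j - 1)) (separation a d (j - 1) ^ 2)))) := by
    rw [LStarProx, LPlusStarProx, LMinusStarProx, one_div_calU_rpow_half _ (sq_nonneg _),
      one_div_calU_rpow_half _ (sq_nonneg _), ENNReal.ofReal_max]
  refine ⟨⟨?_, ?_⟩, ?_, ?_, ?_, ?_⟩
  · obtain ⟨k, rfl⟩ : ∃ k', k = k' + 1 := ⟨k - 1, by omega⟩
    rw [hroot k (by omega), hroot _ (by omega), hconst k (by omega) (by omega)]
  · obtain ⟨k, rfl⟩ : ∃ k', k = k' + 1 := ⟨k - 1, by omega⟩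
    obtain ⟨K, hK⟩ : ∃ K, newtonVertex a d j = K + 1 := ⟨newtonVertex a d j - 1, by omega⟩
    rw [hK, hroot k (by omega), hroot K (by omega), hconst k (by omega) (by omega),
      hconst K (by omega) (by omega)]
  · intro hA1 ζ hζ _
    rw [hL]
    refine ofReal_mul_pow_le_of_forall_lt hn.ne' (fun t ht htl => ?_) hc0
    refine hbound 1 one_ne_zero (fun r hr => ?_) ζ hζ t ht ?_
    · simpa [haj] using mahlerMeasure_le_of_assumptionA1 hA1 A d hA0 hNA0 hr
    · simpa using htl
  · intro hA2 ζ hζ _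
    rw [hLs]
    refine ofReal_mul_pow_le_of_forall_lt hn.ne' (fun t ht htl => ?_) hc0
    refine hbound 2 two_ne_zero (fun r hr => ?_) ζ hζ t ht ?_
    · simpa [haj] using mahlerMeasure_sq_le_of_assumptionA2 hn hA2 A d hA0 hNA0 hr
    · rw [lt_max_iff, Real.lt_sqrt ht.le, Real.lt_sqrt ht.le] at htl
      exact htl
  · rw [hL, hLs]
    exact ENNReal.ofReal_le_ofReal
      (max_le_max (invCalU_le_sqrt _ (hδ _)) (invCalU_le_sqrt _ (hδ _)))
  · intro hk
    refine ⟨⟨le_max_left _ _, ?_⟩, le_max_left _ _, ?_⟩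
    · rw [LPlusProx, one_div_calU _ (hδ _), ← hk, Nat.sub_self, invCalU_zero (hδ _)]
    · rw [LPlusStarProx, one_div_calU_rpow_half _ (sq_nonneg _), ← hk, Nat.sub_self,
        invCalU_zero_sq (hδ _)]
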